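/- Conventions. An $\ell$-permutation group $(G,\Omega)$ is a subgroup $G$ of $\mathrm{Aut}(\Omega,\leqslant)$, $\Omega$ a totally ordered set, closed under the pointwise maximum $\vee$ and minimum $\wedge$. It is *transitive* if $G$ is transitive on $\Omega$, and *o-2 transitive* if $G$ is transitive on the pairs $(\alpha,\beta)\in\Omega^2$ with $\alpha<\beta$. $\equiv$ denotes elementary equivalence in the first-order language $\{1,\cdot,{}^{-1},\vee,\wedge\}$ of lattice-ordered groups. For $g\in G$ let $\mathrm{supp}(g)=\{\alpha\in\Omega\mid \alpha g\neq\alpha\}$. Let $(G,\Omega)$ be a transitive $\ell$-permutation group. A *convex congruence* is a $G$-invariant equivalence relation on $\Omega$ all of whose classes are convex; the convex congruences are totally ordered by inclusion. For $\alpha\ne\beta$ in $\Omega$ let $V(\alpha,\beta)$ be the intersection of all convex congruences for which $\alpha,\beta$ lie in the same class. The *spine* is $\mathfrak K_G=\{V(\alpha,\beta)\mid \alpha,\beta\in\Omega,\ \alpha\neq\beta\}$, totally ordered by inclusion, and $T_G$ is the set of all classes of members of $\mathfrak K_G$, partially ordered by inclusion. Each $K\in\mathfrak K_G$ covers a unique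 convex congruence $\pi(K)$, the largest one properly contained in $K$. If $\Delta$ is a $K$-class, let $\pi(\Delta)$ be the set of $\pi(K)$-classes contained in $\Delta$, with the order inherited from $\Omega$, and let $G(\Delta)$ be the group of automorphisms of $\pi(\Delta)$ induced by the elements $g\in G$ with $\Delta g=\Delta$. The $\ell$-permutation groups $(G(\Delta),\pi(\Delta))$ are the *o-primitive components* of $(G,\Omega)$; up to isomorphism $(G(\Delta),\pi(\Delta))$ depends only on $K$, and $G_K$ denotes $G(\Delta)$ for any $K$-class $\Delta$. * $(G,\Omega)$ is *abundant* if for all $\Delta\in T_G$ and $g\in G$ with $\Delta g=\Delta$, the automorphism of $\Omega$ that agrees with $g$ on $\Delta$ and with the identity off $\Delta$ belongs to $G$. * $(\dagger)$: if $\Delta$ is a minimal element of $T_G$, then for all $\alpha<\beta$ in $\Delta$ there is $g\in G$ with $g\neq1$ and $\mathrm{supp}(g)\subseteq[\alpha,\beta]$. * $(\dagger\dagger)$: every o-primitive component of $(G,\Omega)$ that is o-2 transitive has an irreducible element, where an element $g$ of an $\ell$-group is *irreducible* if $g>1$ and, whenever $g_1\vee g_2=g$ and $g_1\wedge g_2=1$,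 we have $g_1=1$ or $g_2=1$. **Statement.** Let $(G,\Omega)$ and $(H,\Lambda)$ be abundant transitive $\ell$-permutation groups that satisfy $(\dagger)$ and $(\dagger\dagger)$, and suppose that $H\equiv G$. If $\mathfrak K_G$ is finite with $r$ elements $K_1<\dots<K_r$, then $\mathfrak K_H$ is finite with $r$ elements $K'_1<\dots<K'_r$, and $G_{K_i}\equiv H_{K'_i}$ for each $i$. -/

import Mathlib

open FirstOrder

namespace EllPerm

universe u v

/-! ### The first-order language of lattice-ordered groups -/

/-- Function symbols of the language of lattice-ordered groups: `1`, inverse, multiplication,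
join and meet. -/
inductive EllFunc : ℕ → Type
  | one : EllFunc 0
  | inv : EllFunc 1
  | mul : EllFunc 2
  | sup : EllFunc 2
  | inf : EllFunc 2

/-- The first-order language of lattice-ordered groups (equality is the only relation). -/
def ellLang : FirstOrder.Language.{0, 0} where
  Functions := EllFunc
  Relations := fun _ => Empty

/-- Every group with a lattice structure interprets the language in the obvious way. -/
instance ellStructure (M : Type*) [Group M] [Lattice M] : ellLang.Structure M where
  funMap := fun {_} f => match f with
    | .one => fun _ => 1
    | .inv => fun x => (x 0)⁻¹
    | .mul => fun x => x 0 * x 1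
    | .sup => fun x => x 0 ⊔ x 1
    | .inf => fun x => x 0 ⊓ x 1
  RelMap := fun {_} R => nomatch R

/-- An element `g > 1` is irreducible if it is not the join of two non-trivial elements whose
meet is `1`. -/
def Irred {M : Type*} [Group M] [Lattice M] (g : M) : Prop :=
  1 < g ∧ ∀ g₁ g₂ : M, g₁ ⊔ g₂ = g → g₁ ⊓ g₂ = 1 → g₁ = 1 ∨ g₂ = 1

/-! ### The lattice-ordered group of automorphisms of a chain -/

section Aut

variable {Ω : Type u} [LinearOrder Ω]

/-- The pointwise maximum of two automorphisms of a chain. -/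
def autSup (f g : Ω ≃o Ω) : Ω ≃o Ω :=
  StrictMono.orderIsoOfRightInverse (fun x => max (f x) (g x))
    (fun _ _ h => max_lt_max (f.strictMono h) (g.strictMono h))
    (fun x => min (f.symm x) (g.symm x)) (fun x => by
      rcases le_total (f.symm x) (g.symm x) with h | h
      · have h' : g (f.symm x) ≤ x := by simpa using g.monotone h
        simp [min_eq_left h, max_eq_left h']
      · have h' : f (g.symm x) ≤ x := by simpa using f.monotone h
        simp [min_eq_right h, max_eq_right h'])

/-- The pointwise minimum of two automorphisms of a chain. -/
def autInf (f g : Ω ≃o Ω) : Ω ≃o Ω :=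
  StrictMono.orderIsoOfRightInverse (fun x => min (f x) (g x))
    (fun _ _ h => min_lt_min (f.strictMono h) (g.strictMono h))
    (fun x => max (f.symm x) (g.symm x)) (fun x => by
      rcases le_total (f.symm x) (g.symm x) with h | h
      · have h' : x ≤ f (g.symm x) := by simpa using f.monotone h
        simp [max_eq_right h, min_eq_right h']
      · have h' : x ≤ g (f.symm x) := by simpa using g.monotone h
        simp [max_eq_left h, min_eq_left h'])

/-- The pointwise lattice order on the automorphism group of a chain. -/
instance autLattice : Lattice (Ω ≃o Ω) where
  le f g := ∀ x, f x ≤ g x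
  le_refl _ _ := le_rfl
  le_trans _ _ _ h₁ h₂ x := (h₁ x).trans (h₂ x)
  le_antisymm _ _ h₁ h₂ := OrderIso.ext (funext fun x => le_antisymm (h₁ x) (h₂ x))
  sup := autSup
  inf := autInf
  le_sup_left _ _ _ := le_max_left _ _
  le_sup_right _ _ _ := le_max_right _ _
  sup_le _ _ _ h₁ h₂ x := max_le (h₁ x) (h₂ x)
  inf_le_left _ _ _ := min_le_left _ _
  inf_le_right _ _ _ := min_le_right _ _
  le_inf _ _ _ h₁ h₂ x := le_min (h₁ x) (h₂ x)

theorem aut_sup_apply (f g : Ω ≃o Ω) (x : Ω) : (f ⊔ g) x = max (f x) (g x) := rfl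

theorem aut_inf_apply (f g : Ω ≃o Ω) (x : Ω) : (f ⊓ g) x = min (f x) (g x) := rfl

end Aut

/-- An `ℓ`-permutation group on the chain `Ω`: a subgroup of `Aut(Ω, ≤)` that is also a
sublattice. -/
structure LPermGroup (Ω : Type u) [LinearOrder Ω] extends Subgroup (Ω ≃o Ω) where
  sup_mem' : ∀ {f g : Ω ≃o Ω}, f ∈ carrier → g ∈ carrier → f ⊔ g ∈ carrier
  inf_mem' : ∀ {f g : Ω ≃o Ω}, f ∈ carrier → g ∈ carrier → f ⊓ g ∈ carrier

namespace LPermGroup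

variable {Ω : Type u} [LinearOrder Ω]

/-- An `ℓ`-permutation group is a lattice under the pointwise operations. -/
instance instLattice (G : LPermGroup Ω) : Lattice G.toSubgroup :=
  Subtype.lattice (fun _ _ hf hg => G.sup_mem' hf hg) (fun _ _ hf hg => G.inf_mem' hf hg)

/-- `G` acts transitively on `Ω`. -/
def Transitive (G : LPermGroup Ω) : Prop :=
  ∀ a b : Ω, ∃ g ∈ G.toSubgroup, g a = b

/-- `G` acts transitively on the pairs `(a, b)` with `a < b`. -/
def OTwoTransitive (G : LPermGroup Ω) : Prop :=
  ∀ a b c d : Ω, a < b → c < d → ∃ g ∈ G.toSubgroup, g a = c ∧ g b = d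

/-- A convex congruence: a `G`-invariant equivalence relation with convex classes. -/
structure ConvexCong (G : LPermGroup Ω) (C : Setoid Ω) : Prop where
  invariant : ∀ g ∈ G.toSubgroup, ∀ a b, C a b → C (g a) (g b)
  convex : ∀ a b c, a ≤ b → b ≤ c → C a c → C a b

/-- `V(α, β)`, the intersection of all convex congruences for which `α` and `β` lie in the same
class. -/
def V (G : LPermGroup Ω) (α β : Ω) : Setoid Ω :=
  sInf {C | G.ConvexCong C ∧ C α β}

/-- The spine of `G`, a set of convex congruences ordered by inclusion. -/
def spine (G : LPermGroup Ω) : Set (Setoid Ω) :=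
  {K | ∃ α β, α ≠ β ∧ K = G.V α β}

/-- The root system `T` of `G`: all classes of members of the spine. -/
def rootSystem (G : LPermGroup Ω) : Set (Set Ω) :=
  {Δ | ∃ K ∈ G.spine, Δ ∈ K.classes}

/-- The convex congruence `π(K)` covered by `K ∈ spine`: the largest convex congruence properly
contained in `K`. (The convex congruences of a transitive `G` form a chain, so the supremum is
the union, and for `K = V(α, β)` this is the union of all convex congruences separating
`α` and `β`.) -/
def below (G : LPermGroup Ω) (K : Setoid Ω) : Setoid Ω :=
  sSup {C | G.ConvexCong C ∧ C < K}

theorem below_convex (G : LPermGroup Ω) (K : Setoid Ω) (a b c : Ω) (hab : a ≤ b) (hbc : b ≤ c)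
    (h : G.below K a c) : G.below K a b := by
  have hrel : ∀ x y : Ω, G.below K x y ↔
      Relation.EqvGen (fun x y => ∃ r : Setoid Ω, r ∈ {C | G.ConvexCong C ∧ C < K} ∧ r x y) x y := by
    intro x y
    rw [below, Setoid.sSup_eq_eqvGen]
    rfl
  have key : ∀ x y : Ω,
      Relation.EqvGen (fun x y => ∃ r : Setoid Ω, r ∈ {C | G.ConvexCong C ∧ C < K} ∧ r x y) x y →
      ∀ z, min x y ≤ z → z ≤ max x y → G.below K x z := by
    intro x y hxy
    induction hxy with
    | rel x y hr =>
      obtain ⟨r, hr, hxy⟩ := hr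
      intro z h₁ h₂
      have hz : r x z := by
        rcases le_total x y with hle | hle
        · rw [min_eq_left hle] at h₁
          rw [max_eq_right hle] at h₂
          exact hr.1.convex _ _ _ h₁ h₂ hxy
        · rw [min_eq_right hle] at h₁
          rw [max_eq_left hle] at h₂
          exact r.trans' hxy (hr.1.convex _ _ _ h₁ h₂ (r.symm' hxy))
      exact (hrel x z).2 (Relation.EqvGen.rel _ _ ⟨r, hr, hz⟩)
    | refl x =>
      intro z h₁ h₂
      have : z = x := le_antisymm (by simpa using h₂) (by simpa using h₁)
      exact this ▸ (G.below K).refl' x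
    | symm x y hxy ih =>
      intro z h₁ h₂
      exact (G.below K).trans' ((G.below K).symm' ((hrel x y).2 hxy))
        (ih z (by rwa [min_comm]) (by rwa [max_comm]))
    | trans x y w hxy hyw ih₁ ih₂ =>
      intro z h₁ h₂
      by_cases hz : min x y ≤ z ∧ z ≤ max x y
      · exact ih₁ z hz.1 hz.2
      · refine (G.below K).trans' ((hrel x y).2 hxy) (ih₂ z ?_ ?_)
        all_goals
          simp only [min_le_iff, le_max_iff, not_and_or, not_or, not_le] at *
          grind
  exact key a c ((hrel a c).1 h) b (by rw [min_eq_left (hab.trans hbc)]; exact hab)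
    (by rw [max_eq_right (hab.trans hbc)]; exact hbc)

/-- `π(Δ)`: the set of `π(K)`-classes contained in the `K`-class `Δ`. -/
def Blocks (G : LPermGroup Ω) (K : Setoid Ω) (Δ : Set Ω) : Type u :=
  Quotient ((G.below K).comap (Subtype.val : Δ → Ω))

/-- The `π(K)`-class of a point of `Δ`. -/
def Blocks.mk (G : LPermGroup Ω) (K : Setoid Ω) (Δ : Set Ω) (x : Δ) : G.Blocks K Δ :=
  Quotient.mk _ x

theorem blocks_ordConnected (G : LPermGroup Ω) (K : Setoid Ω) (Δ : Set Ω)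
    (q : Quotient ((G.below K).comap (Subtype.val : Δ → Ω))) :
    Set.OrdConnected (Quotient.mk ((G.below K).comap (Subtype.val : Δ → Ω)) ⁻¹' {q}) := by
  refine ⟨fun x hx y hy z hz => ?_⟩
  have hq : Quotient.mk ((G.below K).comap (Subtype.val : Δ → Ω)) x = Quotient.mk _ y :=
    (hx : _ = q).trans (hy : _ = q).symm
  have hxy := Quotient.exact hq
  have hxz : G.below K (x : Ω) (z : Ω) := G.below_convex K _ _ _ hz.1 hz.2
    (Setoid.comap_rel _ _ x y |>.1 hxy)
  have : Quotient.mk ((G.below K).comap (Subtype.val : Δ → Ω)) x = Quotient.mk _ z :=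
    Quotient.sound hxz
  exact this.symm.trans hx

open Classical in
/-- The total order on `π(Δ)` inherited from `Ω`: the class of `x` is at most the class of `y`
if and only if `x ≤ y` or the two classes are equal. -/
noncomputable instance instBlocks (G : LPermGroup Ω) (K : Setoid Ω) (Δ : Set Ω) :
    LinearOrder (G.Blocks K Δ) :=
  haveI := G.blocks_ordConnected K Δ
  inferInstanceAs (LinearOrder (Quotient ((G.below K).comap (Subtype.val : Δ → Ω))))

theorem Blocks.mk_mono (G : LPermGroup Ω) (K : Setoid Ω) (Δ : Set Ω) :
    Monotone (Blocks.mk G K Δ) :=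
  Quotient.mk_monotone

/-- The relation `e = g_Δ`: the automorphism `g` stabilizes `Δ` and induces `e` on `π(Δ)`. -/
def Induces (G : LPermGroup Ω) (K : Setoid Ω) (Δ : Set Ω) (g : Ω ≃o Ω)
    (e : G.Blocks K Δ ≃o G.Blocks K Δ) : Prop :=
  ∃ hg : ∀ x, g x ∈ Δ ↔ x ∈ Δ, ∀ x : Δ, e (Blocks.mk G K Δ x) = Blocks.mk G K Δ ⟨g x, (hg x).2 x.2⟩

/-- The o-primitive component `(G(Δ), π(Δ))`, an `ℓ`-permutation group: all automorphisms of
`π(Δ)` induced by elements of the stabilizer of `Δ`. -/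
def component (G : LPermGroup Ω) (K : Setoid Ω) (Δ : Set Ω) : LPermGroup (G.Blocks K Δ) where
  carrier := {e | ∃ g ∈ G.toSubgroup, G.Induces K Δ g e}
  one_mem' := ⟨1, G.one_mem, fun _ => Iff.rfl, fun _ => rfl⟩
  mul_mem' := by
    rintro e f ⟨g, hg, hgΔ, he⟩ ⟨k, hk, hkΔ, hf⟩
    refine ⟨g * k, G.mul_mem hg hk, fun x => (hgΔ (k x)).trans (hkΔ x), fun x => ?_⟩
    change e (f _) = _
    rw [hf, he]
    rfl
  inv_mem' := by
    rintro e ⟨g, hg, hgΔ, he⟩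
    have hΔ : ∀ x, g.symm x ∈ Δ ↔ x ∈ Δ := fun x => by
      rw [← hgΔ (g.symm x), OrderIso.apply_symm_apply]
    refine ⟨g⁻¹, G.inv_mem hg, hΔ, fun x => ?_⟩
    change e.symm _ = _
    rw [OrderIso.symm_apply_eq, he]
    congr 1
    exact Subtype.ext (g.apply_symm_apply _).symm
  sup_mem' := by
    rintro e f ⟨g, hg, hgΔ, he⟩ ⟨k, hk, hkΔ, hf⟩
    have hΔ : ∀ x, (g ⊔ k) x ∈ Δ ↔ x ∈ Δ := fun x => by
      rw [aut_sup_apply]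
      rcases max_choice (g x) (k x) with h | h <;> rw [h]
      · exact hgΔ x
      · exact hkΔ x
    refine ⟨g ⊔ k, G.sup_mem' hg hk, hΔ, fun x => ?_⟩
    rw [aut_sup_apply, he, hf, ← (Blocks.mk_mono G K Δ).map_max]
    congr 1
  inf_mem' := by
    rintro e f ⟨g, hg, hgΔ, he⟩ ⟨k, hk, hkΔ, hf⟩
    have hΔ : ∀ x, (g ⊓ k) x ∈ Δ ↔ x ∈ Δ := fun x => by
      rw [aut_inf_apply]
      rcases min_choice (g x) (k x) with h | h <;> rw [h]
      · exact hgΔ x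
      · exact hkΔ x
    refine ⟨g ⊓ k, G.inf_mem' hg hk, hΔ, fun x => ?_⟩
    rw [aut_inf_apply, he, hf, ← (Blocks.mk_mono G K Δ).map_min]
    congr 1

/-- `G` is abundant: for `Δ` in the root system and `g ∈ G` with `Δ g = Δ`, the automorphism
that agrees with `g` on `Δ` and is the identity elsewhere belongs to `G`. -/
def Abundant (G : LPermGroup Ω) : Prop :=
  ∀ Δ ∈ G.rootSystem, ∀ g ∈ G.toSubgroup, g '' Δ = Δ →
    ∃ d ∈ G.toSubgroup, (∀ x ∈ Δ, d x = g x) ∧ ∀ x ∉ Δ, d x = x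

/-- Hypothesis (†): if `Δ` is a minimal element of the root system, then every bounded
(non-degenerate) interval of `Δ` contains the support of a non-trivial element of `G`. -/
def Dagger (G : LPermGroup Ω) : Prop :=
  ∀ Δ, Minimal (· ∈ G.rootSystem) Δ → ∀ a ∈ Δ, ∀ b ∈ Δ, a < b →
    ∃ g ∈ G.toSubgroup, g ≠ 1 ∧ {x | g x ≠ x} ⊆ Set.Icc a b

/-- Hypothesis (††): every o-2 transitive component has irreducible elements. -/
def DDagger (G : LPermGroup Ω) : Prop :=
  ∀ K ∈ G.spine, ∀ Δ ∈ K.classes, (G.component K Δ).OTwoTransitive →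
    ∃ e : (G.component K Δ).toSubgroup, Irred e

end LPermGroup

end EllPerm

/-! The spine and its components can be recovered from the bare lattice-ordered group. Orthogonality
`|a| ⊓ |b| = 1` is first-order and says that supports are disjoint (`orth_iff`). The hull of `g` is
the bipolar of the conjugates of `g` that are not orthogonal to `g`. If `g` is supported in a class
Δ of a spine member and these conjugates together move every point of Δ, then the hull is exactly
the group of elements supported in Δ (`represents_of_spread`). Every Δ in the root system admits
such a `g` (`exists_spread`, `exists_represents`). Conversely, the first-order condition `IsGood`
forces the hull of `g` to consist of the elements supported in one class of a non-trivial convex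
congruence (`exists_convexCong_of_isGood`).

Inclusion of hulls is inclusion of classes, so the length of chains of hulls below `g` measures the
height of its class. A finite spine contains all non-trivial convex congruences; hence if it has `m`
members, a good element with a chain of `n` hulls below it exists exactly when `n < m`
(`exists_hasChain_iff`). An infinite spine admits chains of every length. Elementary equivalence
therefore transfers finiteness and the number of members.

By abundance, the component at Δ is the quotient of the group of elements supported in Δ by those
that stabilize every class of the next congruence down (`exists_isQuotient`). Both groups are
definable from a `g` representing Δ (`inKer_iff`), so a sentence about the component becomes a
formula about `g` (`realize_translate`). Elements of the same level represent classes of the same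
congruence, and conjugation carries one class to another; the choice of `g` is thus immaterial and
the parameter can be quantified away (`component_realize_iff`). -/

namespace EllPerm

universe u v

/-! ### Uniformly definable functions and predicates -/

section Definability

open FirstOrder.Language

variable {A : Type u} {B : Type v} [Group A] [Lattice A] [Group B] [Lattice B] {α : Type}

/-- `f` and `f'` are given by the same term of the language of lattice-ordered groups. -/
def TDef (f : (α → A) → A) (f' : (α → B) → B) : Prop :=
  ∃ t : ellLang.Term α, (∀ v : α → A, t.realize v = f v) ∧ ∀ v : α → B, t.realize v = f' v

/-- `P` and `P'` are given by the same formula of the language of lattice-ordered groups. -/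
def UDef (P : (α → A) → Prop) (P' : (α → B) → Prop) : Prop :=
  ∃ φ : ellLang.Formula α, (∀ v : α → A, φ.Realize v ↔ P v) ∧ ∀ v : α → B, φ.Realize v ↔ P' v

namespace TDef

variable {f g : (α → A) → A} {f' g' : (α → B) → B}

theorem var (i : α) : TDef (fun v : α → A => v i) (fun v : α → B => v i) :=
  ⟨Term.var i, fun _ => rfl, fun _ => rfl⟩

theorem one : TDef (fun _ : α → A => 1) (fun _ : α → B => 1) :=
  ⟨Term.func (L := ellLang) EllFunc.one ![], fun _ => rfl, fun _ => rfl⟩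

theorem inv (hf : TDef f f') : TDef (fun v => (f v)⁻¹) (fun v => (f' v)⁻¹) := by
  obtain ⟨t, h, h'⟩ := hf
  refine ⟨Term.func (L := ellLang) EllFunc.inv ![t], fun v => ?_, fun v => ?_⟩
  · exact congrArg (·⁻¹) (h v)
  · exact congrArg (·⁻¹) (h' v)

theorem mul (hf : TDef f f') (hg : TDef g g') :
    TDef (fun v => f v * g v) (fun v => f' v * g' v) := by
  obtain ⟨t, h, h'⟩ := hf
  obtain ⟨s, k, k'⟩ := hg
  refine ⟨Term.func (L := ellLang) EllFunc.mul ![t, s], fun v => ?_, fun v => ?_⟩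
  · exact congrArg₂ (· * ·) (h v) (k v)
  · exact congrArg₂ (· * ·) (h' v) (k' v)

theorem sup (hf : TDef f f') (hg : TDef g g') :
    TDef (fun v => f v ⊔ g v) (fun v => f' v ⊔ g' v) := by
  obtain ⟨t, h, h'⟩ := hf
  obtain ⟨s, k, k'⟩ := hg
  refine ⟨Term.func (L := ellLang) EllFunc.sup ![t, s], fun v => ?_, fun v => ?_⟩
  · exact congrArg₂ (· ⊔ ·) (h v) (k v)
  · exact congrArg₂ (· ⊔ ·) (h' v) (k' v)

theorem inf (hf : TDef f f') (hg : TDef g g') :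
    TDef (fun v => f v ⊓ g v) (fun v => f' v ⊓ g' v) := by
  obtain ⟨t, h, h'⟩ := hf
  obtain ⟨s, k, k'⟩ := hg
  refine ⟨Term.func (L := ellLang) EllFunc.inf ![t, s], fun v => ?_, fun v => ?_⟩
  · exact congrArg₂ (· ⊓ ·) (h v) (k v)
  · exact congrArg₂ (· ⊓ ·) (h' v) (k' v)

theorem conj (hf : TDef f f') (hg : TDef g g') :
    TDef (fun v => f v * g v * (f v)⁻¹) (fun v => f' v * g' v * (f' v)⁻¹) :=
  (hf.mul hg).mul hf.inv

/-- A definable function may be regarded as a function of one more variable. -/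
theorem lift (hf : TDef f f') :
    TDef (fun v : α ⊕ Unit → A => f (v ∘ Sum.inl)) (fun v : α ⊕ Unit → B => f' (v ∘ Sum.inl)) := by
  obtain ⟨t, h, h'⟩ := hf
  exact ⟨t.relabel Sum.inl, fun v => Term.realize_relabel.trans (h _),
    fun v => Term.realize_relabel.trans (h' _)⟩

/-- The last variable. -/
theorem last : TDef (fun v : α ⊕ Unit → A => v (Sum.inr ())) (fun v : α ⊕ Unit → B => v (Sum.inr ())) :=
  var _

end TDef

namespace UDef

variable {f g : (α → A) → A} {f' g' : (α → B) → B}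
  {P Q : (α → A) → Prop} {P' Q' : (α → B) → Prop}

theorem eq (hf : TDef f f') (hg : TDef g g') :
    UDef (fun v => f v = g v) (fun v => f' v = g' v) := by
  obtain ⟨t, h, h'⟩ := hf
  obtain ⟨s, k, k'⟩ := hg
  refine ⟨t.equal s, fun v => ?_, fun v => ?_⟩
  · rw [Formula.realize_equal, h, k]
  · rw [Formula.realize_equal, h', k']

theorem imp (hP : UDef P P') (hQ : UDef Q Q') :
    UDef (fun v => P v → Q v) (fun v => P' v → Q' v) := by
  obtain ⟨φ, h, h'⟩ := hP
  obtain ⟨ψ, k, k'⟩ := hQ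
  refine ⟨φ.imp ψ, fun v => ?_, fun v => ?_⟩
  · rw [Formula.realize_imp, h, k]
  · rw [Formula.realize_imp, h', k']

theorem not (hP : UDef P P') : UDef (fun v => ¬ P v) (fun v => ¬ P' v) := by
  obtain ⟨φ, h, h'⟩ := hP
  refine ⟨φ.not, fun v => ?_, fun v => ?_⟩
  · rw [Formula.realize_not, h]
  · rw [Formula.realize_not, h']

theorem and (hP : UDef P P') (hQ : UDef Q Q') :
    UDef (fun v => P v ∧ Q v) (fun v => P' v ∧ Q' v) := by
  obtain ⟨φ, h, h'⟩ := hP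
  obtain ⟨ψ, k, k'⟩ := hQ
  refine ⟨φ ⊓ ψ, fun v => ?_, fun v => ?_⟩
  · rw [Formula.realize_inf, h, k]
  · rw [Formula.realize_inf, h', k']

theorem or (hP : UDef P P') (hQ : UDef Q Q') :
    UDef (fun v => P v ∨ Q v) (fun v => P' v ∨ Q' v) := by
  simpa only [or_iff_not_imp_left] using hP.not.imp hQ

theorem iff (hP : UDef P P') (hQ : UDef Q Q') :
    UDef (fun v => P v ↔ Q v) (fun v => P' v ↔ Q' v) := by
  simpa only [iff_iff_implies_and_implies] using (hP.imp hQ).and (hQ.imp hP)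

/-- The bound variable is the summand `Unit` adjoined to the context; `TDef.lift` and `TDef.last`
are the matching weakening and newest variable. -/
theorem all {P : (α → A) → A → Prop} {P' : (α → B) → B → Prop}
    (h : UDef (fun v : α ⊕ Unit → A => P (v ∘ Sum.inl) (v (Sum.inr ())))
      (fun v : α ⊕ Unit → B => P' (v ∘ Sum.inl) (v (Sum.inr ())))) :
    UDef (fun v => ∀ a, P v a) (fun v => ∀ b, P' v b) := by
  obtain ⟨φ, h, h'⟩ := h
  refine ⟨φ.iAlls Unit, fun v => ?_, fun v => ?_⟩
  · rw [Formula.realize_iAlls]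
    exact ⟨fun k a => (h _).1 (k fun _ => a), fun k i => (h _).2 (k (i ()))⟩
  · rw [Formula.realize_iAlls]
    exact ⟨fun k a => (h' _).1 (k fun _ => a), fun k i => (h' _).2 (k (i ()))⟩

theorem ex {P : (α → A) → A → Prop} {P' : (α → B) → B → Prop}
    (h : UDef (fun v : α ⊕ Unit → A => P (v ∘ Sum.inl) (v (Sum.inr ())))
      (fun v : α ⊕ Unit → B => P' (v ∘ Sum.inl) (v (Sum.inr ())))) :
    UDef (fun v => ∃ a, P v a) (fun v => ∃ b, P' v b) := by
  have := (all (P := fun v a => ¬ P v a) (P' := fun v a => ¬ P' v a) h.not).not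
  simpa only [not_forall, not_not] using this

/-- Elementarily equivalent structures agree on predicates without variables. -/
theorem transfer {P P' : Prop} (h : UDef (fun _ : Empty → A => P) (fun _ : Empty → B => P'))
    (e : A ≅[ellLang] B) : P ↔ P' := by
  obtain ⟨φ, h, h'⟩ := h
  refine (h default).symm.trans (Iff.trans ?_ (h' default))
  exact elementarilyEquivalent_iff.1 e φ

end UDef

/-- Conjugation, as an automorphism of the lattice-ordered group. -/
def conjEquiv (hl : ∀ c a b : A, c * (a ⊔ b) = c * a ⊔ c * b)
    (hl' : ∀ c a b : A, c * (a ⊓ b) = c * a ⊓ c * b)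
    (hr : ∀ c a b : A, (a ⊔ b) * c = a * c ⊔ b * c)
    (hr' : ∀ c a b : A, (a ⊓ b) * c = a * c ⊓ b * c) (h : A) : A ≃[ellLang] A where
  toEquiv := (MulAut.conj h).toEquiv
  map_fun' := by
    intro n f x
    cases f with
    | one => exact (MulAut.conj h).map_one
    | inv => exact (MulAut.conj h).map_inv _
    | mul => exact (MulAut.conj h).map_mul _ _
    | sup =>
      change h * (x 0 ⊔ x 1) * h⁻¹ = h * x 0 * h⁻¹ ⊔ h * x 1 * h⁻¹
      rw [hl, hr]
    | inf =>
      change h * (x 0 ⊓ x 1) * h⁻¹ = h * x 0 * h⁻¹ ⊓ h * x 1 * h⁻¹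
      rw [hl', hr']
  map_rel' := fun R => nomatch R

/-! ### Predicates on lattice-ordered groups -/

/-- Orthogonality: `|a| ⊓ |b| = 1`. -/
def Orth (a b : A) : Prop := (a ⊔ a⁻¹) ⊓ (b ⊔ b⁻¹) = 1

/-- `k` belongs to the bipolar of the set of the conjugates of `g` not orthogonal to `g`. -/
def InHull (g k : A) : Prop :=
  ∀ f : A, (∀ h : A, ¬ Orth (h * g * h⁻¹) g → Orth f (h * g * h⁻¹)) → Orth f k

/-- Conjugation by `h` preserves the hull of `g`. -/
def Normalizes (g h : A) : Prop := ∀ k : A, InHull g k ↔ InHull g (h * k * h⁻¹)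

/-- The hull of `g ≠ 1` is equal or orthogonal to each of its conjugates, and its normalizer is
convex. -/
def IsGood (g : A) : Prop :=
  g ≠ 1 ∧
  (∀ h : A, Normalizes g h ∨ ∀ k : A, InHull g k → ∀ l : A, InHull g l → Orth k (h * l * h⁻¹)) ∧
  ∀ h k : A, 1 ⊔ h = h → h ⊔ k = k → Normalizes g k → Normalizes g h

/-- The hull of `g` is properly contained in the hull of `g'`. -/
def HullLT (g g' : A) : Prop :=
  (∀ k : A, InHull g k → InHull g' k) ∧ ∃ k : A, InHull g' k ∧ ¬ InHull g k

/-- Below the hull of `g` there is a chain of `n` hulls of good elements. -/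
def HasChain : ℕ → A → Prop
  | 0, g => IsGood g
  | n + 1, g => IsGood g ∧ ∃ g', HasChain n g' ∧ HullLT g' g

theorem HasChain.isGood {n : ℕ} {g : A}
    (h : HasChain n g) : IsGood g := by
  cases n with
  | zero => exact h
  | succ n => exact h.1

/-- The hull of `g` is at height `n` among the hulls of good elements. -/
def HasLevel (n : ℕ) (g : A) : Prop := HasChain n g ∧ ¬ HasChain (n + 1) g

/-- For `g` of level `i` and `z` in the hull of `g`: `z` acts trivially on the component
defined by `g`. -/
def InKer : ℕ → A → A → Prop
  | 0, _, z => z = 1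
  | n + 1, g, z => ∀ g' : A, HasChain n g' → HullLT g' g → Normalizes g' z

/-! ### Definability of hulls, good elements, levels and kernels -/

namespace UDef

variable {f g : (α → A) → A} {f' g' : (α → B) → B}

theorem orth (hf : TDef f f') (hg : TDef g g') :
    UDef (fun v => Orth (f v) (g v)) (fun v => Orth (f' v) (g' v)) :=
  eq ((hf.sup hf.inv).inf (hg.sup hg.inv)) .one

/-- The proof term mirrors the formula: outer functions are lifted once for each quantifier passed,
and `.last` is the variable bound most recently. The same pattern serves for the predicates that
follow. -/
theorem inHull (hf : TDef f f') (hg : TDef g g') :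
    UDef (fun v => InHull (f v) (g v)) (fun v => InHull (f' v) (g' v)) :=
  all (imp (all (imp (not (orth (.conj .last hf.lift.lift) hf.lift.lift))
    (orth (.lift .last) (.conj .last hf.lift.lift)))) (orth .last hg.lift))

theorem normalizes (hf : TDef f f') (hg : TDef g g') :
    UDef (fun v => Normalizes (f v) (g v)) (fun v => Normalizes (f' v) (g' v)) :=
  all (iff (inHull hf.lift .last) (inHull hf.lift (.conj hg.lift .last)))

theorem isGood (hf : TDef f f') :
    UDef (fun v => IsGood (f v)) (fun v => IsGood (f' v)) :=
  and (not (eq hf .one)) (and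
    (all (or (normalizes hf.lift .last)
      (all (imp (inHull hf.lift.lift .last)
        (all (imp (inHull hf.lift.lift.lift .last) (orth (.lift .last)
          (.conj (.lift (.lift .last)) .last))))))))
    (all (all (imp (eq (.sup .one (.lift .last)) (.lift .last))
      (imp (eq (.sup (.lift .last) .last) .last)
        (imp (normalizes hf.lift.lift .last) (normalizes hf.lift.lift (.lift .last))))))))

theorem hullLT (hf : TDef f f') (hg : TDef g g') :
    UDef (fun v => HullLT (f v) (g v)) (fun v => HullLT (f' v) (g' v)) :=
  and (all (imp (inHull hf.lift .last) (inHull hg.lift .last)))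
    (ex (and (inHull hg.lift .last) (not (inHull hf.lift .last))))

/-- There is one formula for each external number `n`. The context `α` varies in the induction
because the existential quantifier enlarges it. -/
theorem hasChain (n : ℕ) {α : Type} {f : (α → A) → A} {f' : (α → B) → B} (hf : TDef f f') :
    UDef (fun v => HasChain n (f v)) (fun v => HasChain n (f' v)) := by
  induction n generalizing α with
  | zero => exact isGood hf
  | succ n ih => exact and (isGood hf) (ex (and (ih .last) (hullLT .last hf.lift)))

theorem hasLevel (n : ℕ) (hf : TDef f f') :
    UDef (fun v => HasLevel n (f v)) (fun v => HasLevel n (f' v)) :=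
  and (hasChain n hf) (not (hasChain (n + 1) hf))

theorem inKer (n : ℕ) (hf : TDef f f') (hg : TDef g g') :
    UDef (fun v => InKer n (f v) (g v)) (fun v => InKer n (f' v) (g' v)) := by
  cases n with
  | zero => exact eq hg .one
  | succ n =>
    exact all (imp (hasChain n .last) (imp (hullLT .last hf.lift) (normalizes .last hg.lift)))

end UDef

/-! ### Interpretation of a quotient of a definable subset -/

/-- Translation of formulas about a quotient of the set defined by `δ`, with kernel defined
by `ν`, into formulas with one parameter. -/
noncomputable def translate (δ ν : ellLang.Formula (Fin 2)) :
    ∀ {n : ℕ}, ellLang.BoundedFormula Empty n → ellLang.Formula (Unit ⊕ Fin n)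
  | _, .falsum => ⊥
  | _, .equal t s => BoundedFormula.subst ν ![Term.var (Sum.inl ()),
      Term.func (L := ellLang) EllFunc.mul ![t.relabel (Sum.map Empty.elim id),
        Term.func (L := ellLang) EllFunc.inv ![s.relabel (Sum.map Empty.elim id)] ] ]
  | _, .rel R _ => nomatch R
  | _, .imp φ ψ => (translate δ ν φ).imp (translate δ ν ψ)
  | n, .all φ => Formula.iAlls Unit (α := Unit ⊕ Fin n)
      ((Formula.relabel ![Sum.inl (Sum.inl ()), Sum.inr ()] δ).imp
        (Formula.relabel (Sum.elim (fun _ => Sum.inl (Sum.inl ()))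
          (Fin.snoc (α := fun _ => (Unit ⊕ Fin n) ⊕ Unit) (fun i => Sum.inl (Sum.inr i))
            (Sum.inr ()))) (translate δ ν φ)))

/-- A map `ρ : M → Q` whose restriction to `D` is a surjective homomorphism with kernel `N`. -/
structure IsQuotient {M Q : Type*} [Group M] [Lattice M] [Group Q] [Lattice Q]
    (D N : M → Prop) (ρ : M → Q) : Prop where
  one_mem : D 1
  inv_mem : ∀ x, D x → D x⁻¹
  mul_mem : ∀ x y, D x → D y → D (x * y)
  sup_mem : ∀ x y, D x → D y → D (x ⊔ y)
  inf_mem : ∀ x y, D x → D y → D (x ⊓ y)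
  map_one : ρ 1 = 1
  map_inv : ∀ x, D x → ρ x⁻¹ = (ρ x)⁻¹
  map_mul : ∀ x y, D x → D y → ρ (x * y) = ρ x * ρ y
  map_sup : ∀ x y, D x → D y → ρ (x ⊔ y) = ρ x ⊔ ρ y
  map_inf : ∀ x y, D x → D y → ρ (x ⊓ y) = ρ x ⊓ ρ y
  surj : ∀ q, ∃ x, D x ∧ ρ x = q
  map_eq : ∀ x y, D x → D y → (ρ x = ρ y ↔ N (x * y⁻¹))

theorem IsQuotient.realize {M Q : Type*} [Group M] [Lattice M] [Group Q] [Lattice Q]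
    {D N : M → Prop} {ρ : M → Q} (hq : IsQuotient D N ρ) {β : Type} (t : ellLang.Term β)
    (v : β → M) (hv : ∀ i, D (v i)) :
    D (t.realize v) ∧ ρ (t.realize v) = t.realize (ρ ∘ v) := by
  induction t with
  | var i => exact ⟨hv i, rfl⟩
  | @func l F ts ih =>
    cases F with
    | one => exact ⟨hq.one_mem, hq.map_one⟩
    | inv =>
      exact ⟨hq.inv_mem _ (ih 0).1, (hq.map_inv _ (ih 0).1).trans (congrArg (·⁻¹) (ih 0).2)⟩
    | mul =>
      exact ⟨hq.mul_mem _ _ (ih 0).1 (ih 1).1,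
        (hq.map_mul _ _ (ih 0).1 (ih 1).1).trans (congrArg₂ (· * ·) (ih 0).2 (ih 1).2)⟩
    | sup =>
      exact ⟨hq.sup_mem _ _ (ih 0).1 (ih 1).1,
        (hq.map_sup _ _ (ih 0).1 (ih 1).1).trans (congrArg₂ (· ⊔ ·) (ih 0).2 (ih 1).2)⟩
    | inf =>
      exact ⟨hq.inf_mem _ _ (ih 0).1 (ih 1).1,
        (hq.map_inf _ _ (ih 0).1 (ih 1).1).trans (congrArg₂ (· ⊓ ·) (ih 0).2 (ih 1).2)⟩

/-- Two terms agree in the quotient exactly when `t * s⁻¹` lies in the kernel, which settles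
equations; since `ρ` maps `D` onto `Q`, quantifiers over `Q` amount to quantifiers relativized to
`D`. -/
theorem realize_translate {M Q : Type*} [Group M] [Lattice M] [Group Q] [Lattice Q]
    {D N : M → Prop} {ρ : M → Q} (hq : IsQuotient D N ρ) {δ ν : ellLang.Formula (Fin 2)} {g : M}
    (hδ : ∀ y, δ.Realize ![g, y] ↔ D y) (hν : ∀ y, ν.Realize ![g, y] ↔ N y)
    {n : ℕ} (φ : ellLang.BoundedFormula Empty n) (x : Fin n → M) (hx : ∀ i, D (x i)) :
    (translate δ ν φ).Realize (Sum.elim (fun _ => g) x) ↔ φ.Realize default (ρ ∘ x) := by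
  induction φ with
  | falsum => rfl
  | @equal n t s =>
    -- Terms are evaluated inside `D`, and `ρ` commutes with this evaluation; the relabelling only
    -- makes room for the parameter `g`.
    have key : ∀ t : ellLang.Term (Empty ⊕ Fin n),
        D ((t.relabel (Sum.map Empty.elim id : _ → Unit ⊕ Fin n)).realize
          (Sum.elim (fun _ => g) x)) ∧
        ρ ((t.relabel (Sum.map Empty.elim id : _ → Unit ⊕ Fin n)).realize
          (Sum.elim (fun _ => g) x)) = t.realize (Sum.elim default (ρ ∘ x)) := by
      intro t
      rw [Term.realize_relabel]
      have := hq.realize t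
        (Sum.elim (fun _ : Unit => g) x ∘ Sum.map Empty.elim id)
        (by rintro (i | i); exacts [i.elim, hx i])
      refine ⟨this.1, this.2.trans (congrArg (fun w => t.realize w) ?_)⟩
      ext (i | i)
      exacts [i.elim, rfl]
    change BoundedFormula.Realize (BoundedFormula.subst ν _) _ _ ↔
      t.realize (Sum.elim default (ρ ∘ x)) = s.realize (Sum.elim default (ρ ∘ x))
    rw [BoundedFormula.realize_subst, ← (key t).2, ← (key s).2,
      hq.map_eq _ _ (key t).1 (key s).1, ← hν]
    change ν.Realize _ ↔ _
    refine iff_of_eq (congrArg ν.Realize ?_)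
    funext i
    fin_cases i <;> rfl
  | rel R => exact nomatch R
  | imp φ ψ ih₁ ih₂ =>
    change Formula.Realize (Formula.imp _ _) _ ↔ _
    rw [Formula.realize_imp, ih₁ x hx, ih₂ x hx]
    rfl
  | @all n φ ih =>
    have key : ∀ y, D y → ((translate δ ν φ).Realize
        (Sum.elim (fun _ => g) (Fin.snoc (α := fun _ => M) x y)) ↔
        φ.Realize default (Fin.snoc (α := fun _ => Q) (ρ ∘ x) (ρ y))) := by
      intro y hy
      rw [ih, Fin.comp_snoc]
      intro i
      refine Fin.lastCases ?_ (fun j => ?_) i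
      · simpa using hy
      · simpa using hx j
    change Formula.Realize (Formula.iAlls Unit (α := Unit ⊕ Fin n) _) (Sum.elim (fun _ => g) x) ↔
      ∀ q : Q, φ.Realize default (Fin.snoc (α := fun _ => Q) (ρ ∘ x) q)
    rw [Formula.realize_iAlls]
    have step : ∀ i : Unit → M, Formula.Realize
        ((Formula.relabel ![Sum.inl (Sum.inl ()), Sum.inr ()] δ).imp
        (Formula.relabel (Sum.elim (fun _ => Sum.inl (Sum.inl ()))
          (Fin.snoc (α := fun _ => (Unit ⊕ Fin n) ⊕ Unit) (fun i => Sum.inl (Sum.inr i))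
            (Sum.inr ()))) (translate δ ν φ))) (Sum.elim (Sum.elim (fun _ => g) x) i) ↔
        (D (i ()) → φ.Realize default (Fin.snoc (α := fun _ => Q) (ρ ∘ x) (ρ (i ())))) := by
      intro i
      rw [Formula.realize_imp, Formula.realize_relabel, Formula.realize_relabel]
      refine imp_congr_ctx ?_ fun hi => ?_
      · rw [← hδ]
        refine iff_of_eq (congrArg δ.Realize ?_)
        funext j
        fin_cases j <;> rfl
      · rw [← key _ hi]
        refine iff_of_eq (congrArg (translate δ ν φ).Realize ?_)
        ext (j | j)
        · rfl
        · refine Fin.lastCases ?_ (fun j => ?_) j <;> simp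
    constructor
    · intro h q
      obtain ⟨y, hy, rfl⟩ := hq.surj q
      exact (step fun _ => y).1 (h _) hy
    · exact fun h i => (step i).2 fun _ => h _

end Definability

namespace LPermGroup

/-! ### Classes of an equivalence relation -/

theorem mem_class_iff {Ω : Type u} {C : Setoid Ω} {Δ : Set Ω} (hΔ : Δ ∈ C.classes) {x : Ω} (hx : x ∈ Δ)
    (y : Ω) : y ∈ Δ ↔ C x y := by
  obtain ⟨z, rfl⟩ := hΔ
  exact ⟨fun hy => C.trans' hx (C.symm' hy), fun hy => C.trans' (C.symm' hy) hx⟩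

theorem class_nonempty {Ω : Type u} {C : Setoid Ω} {Δ : Set Ω} (hΔ : Δ ∈ C.classes) : Δ.Nonempty := by
  obtain ⟨z, rfl⟩ := hΔ
  exact ⟨z, C.refl' z⟩

theorem class_of {Ω : Type u} (C : Setoid Ω) (x : Ω) : {y | C x y} ∈ C.classes :=
  ⟨x, Set.ext fun _ => ⟨fun h => C.symm' h, fun h => C.symm' h⟩⟩

variable {Ω : Type u} [LinearOrder Ω] {G : LPermGroup Ω}

/-! ### The action on points -/

theorem mul_act (g h : G.toSubgroup) (x : Ω) : (g * h).1 x = g.1 (h.1 x) := rfl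

theorem one_act (x : Ω) : (1 : G.toSubgroup).1 x = x := rfl

theorem sup_act (g h : G.toSubgroup) (x : Ω) : (g ⊔ h).1 x = max (g.1 x) (h.1 x) := rfl

theorem inf_act (g h : G.toSubgroup) (x : Ω) : (g ⊓ h).1 x = min (g.1 x) (h.1 x) := rfl

theorem inv_act_act (g : G.toSubgroup) (x : Ω) : (g⁻¹).1 (g.1 x) = x :=
  g.1.symm_apply_apply x

theorem act_inv_act (g : G.toSubgroup) (x : Ω) : g.1 ((g⁻¹).1 x) = x :=
  g.1.apply_symm_apply x

theorem act_le (g : G.toSubgroup) {x y : Ω} : g.1 x ≤ g.1 y ↔ x ≤ y := g.1.le_iff_le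

theorem act_lt (g : G.toSubgroup) {x y : Ω} : g.1 x < g.1 y ↔ x < y := g.1.lt_iff_lt

theorem act_inj (g : G.toSubgroup) {x y : Ω} : g.1 x = g.1 y ↔ x = y := g.1.injective.eq_iff

theorem conj_act (h g : G.toSubgroup) (x : Ω) :
    (h * g * h⁻¹).1 x = h.1 (g.1 ((h⁻¹).1 x)) := rfl

theorem conj_act_act (h g : G.toSubgroup) (x : Ω) :
    (h * g * h⁻¹).1 (h.1 x) = h.1 (g.1 x) := by
  rw [conj_act, inv_act_act]

theorem ext_act {g h : G.toSubgroup} (H : ∀ x, g.1 x = h.1 x) : g = h :=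
  Subtype.ext (OrderIso.ext (funext H))

theorem Transitive.exists_act (hG : G.Transitive) (a b : Ω) : ∃ g : G.toSubgroup, g.1 a = b := by
  obtain ⟨g, hg, h⟩ := hG a b
  exact ⟨⟨g, hg⟩, h⟩

/-- Conjugation by an element of an `ℓ`-permutation group, as an automorphism. -/
def conjAut (h : G.toSubgroup) : G.toSubgroup ≃[ellLang] G.toSubgroup :=
  conjEquiv (fun c _ _ => ext_act fun _ => c.1.monotone.map_max)
    (fun c _ _ => ext_act fun _ => c.1.monotone.map_min)
    (fun _ _ _ => ext_act fun _ => rfl) (fun _ _ _ => ext_act fun _ => rfl) h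

theorem le_abs_act (a : G.toSubgroup) (x : Ω) : x ≤ (a ⊔ a⁻¹).1 x := by
  rw [sup_act, le_max_iff]
  refine (le_total x (a.1 x)).imp_right fun h => ?_
  rwa [← act_le a, act_inv_act]

theorem abs_act_eq (a : G.toSubgroup) (x : Ω) : (a ⊔ a⁻¹).1 x = x ↔ a.1 x = x := by
  rw [sup_act]
  constructor
  · intro h
    have h₁ : a.1 x ≤ x := le_of_le_of_eq (le_max_left _ _) h
    have h₂ : (a⁻¹).1 x ≤ x := le_of_le_of_eq (le_max_right _ _) h
    rw [← act_le a, act_inv_act] at h₂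
    exact le_antisymm h₁ h₂
  · intro h
    have h' : (a⁻¹).1 x = x := by rw [← act_inj a, act_inv_act, h]
    rw [h, h', max_self]

/-- Two elements are orthogonal if and only if their supports are disjoint. -/
theorem orth_iff (a b : G.toSubgroup) : Orth a b ↔ ∀ x, a.1 x = x ∨ b.1 x = x := by
  have : Orth a b ↔ ∀ x, min ((a ⊔ a⁻¹).1 x) ((b ⊔ b⁻¹).1 x) = x :=
    ⟨fun h x => congrArg (fun g : G.toSubgroup => g.1 x) h, fun h => ext_act h⟩
  rw [this]
  refine forall_congr' fun x => ?_
  rw [← abs_act_eq a, ← abs_act_eq b]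
  constructor
  · intro h
    rcases min_choice ((a ⊔ a⁻¹).1 x) ((b ⊔ b⁻¹).1 x) with h' | h' <;> rw [h'] at h
    · exact Or.inl h
    · exact Or.inr h
  · rintro (h | h)
    · rw [h, min_eq_left (le_abs_act b x)]
    · rw [h, min_eq_right (le_abs_act a x)]

/-! ### Convex congruences -/

theorem ConvexCong.act {C : Setoid Ω} (hC : G.ConvexCong C) (g : G.toSubgroup) {a b : Ω} :
    C (g.1 a) (g.1 b) ↔ C a b := by
  refine ⟨fun h => ?_, hC.invariant g.1 g.2 a b⟩
  simpa only [inv_act_act] using hC.invariant (g⁻¹).1 (g⁻¹).2 _ _ h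

theorem ConvexCong.act_mem_iff {C : Setoid Ω} (hC : G.ConvexCong C) {Δ : Set Ω}
    (hΔ : Δ ∈ C.classes) {g : G.toSubgroup} {x : Ω} (hx : x ∈ Δ) (hgx : g.1 x ∈ Δ) (y : Ω) :
    g.1 y ∈ Δ ↔ y ∈ Δ := by
  rw [mem_class_iff hΔ hgx, mem_class_iff hΔ hx, hC.act]

theorem V_rel (α β : Ω) : G.V α β α β := fun _ h => h.2

theorem V_convexCong (α β : Ω) : G.ConvexCong (G.V α β) :=
  ⟨fun g hg a b h C hC => hC.1.invariant g hg a b (h C hC),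
    fun a b c h₁ h₂ h C hC => hC.1.convex a b c h₁ h₂ (h C hC)⟩

theorem V_le {C : Setoid Ω} (hC : G.ConvexCong C) {α β : Ω} (h : C α β) : G.V α β ≤ C :=
  sInf_le ⟨hC, h⟩

theorem V_comm (α β : Ω) : G.V α β = G.V β α :=
  le_antisymm (V_le (V_convexCong _ _) (Setoid.symm' _ (V_rel _ _)))
    (V_le (V_convexCong _ _) (Setoid.symm' _ (V_rel _ _)))

theorem V_act (g : G.toSubgroup) (α β : Ω) : G.V (g.1 α) (g.1 β) = G.V α β :=
  le_antisymm (V_le (V_convexCong _ _) (((V_convexCong _ _).act g).2 (V_rel _ _)))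
    (V_le (V_convexCong _ _) (((V_convexCong _ _).act g).1 (V_rel _ _)))

theorem convexCong_of_mem_spine {K : Setoid Ω} (hK : K ∈ G.spine) : G.ConvexCong K := by
  obtain ⟨α, β, -, rfl⟩ := hK
  exact V_convexCong _ _

/-- `V` is unchanged when both points are moved by the same group element, so the pair generating
`K` can be transported until one of its points is `x`. Which of the two points is the smaller one
decides the final alternative. -/
theorem spine_class (hG : G.Transitive) {K : Setoid Ω} (hK : K ∈ G.spine) {Δ : Set Ω}
    (hΔ : Δ ∈ K.classes) {x : Ω} (hx : x ∈ Δ) :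
    ∃ a c, a < c ∧ K = G.V a c ∧ a ∈ Δ ∧ (x = a ∨ x = c) := by
  obtain ⟨α, β, hne, rfl⟩ := hK
  obtain ⟨t, rfl⟩ := hG.exists_act α x
  rw [← V_act t] at hΔ ⊢
  have hβ : t.1 β ∈ Δ := (mem_class_iff hΔ hx _).2 (V_rel _ _)
  rcases lt_or_gt_of_ne hne with h | h
  · exact ⟨_, _, (act_lt t).2 h, rfl, hx, Or.inl rfl⟩
  · exact ⟨_, _, (act_lt t).2 h, V_comm _ _, hβ, Or.inr rfl⟩

theorem Abundant.exists_cut (hG : G.Abundant) {K : Setoid Ω} (hK : K ∈ G.spine) {Δ : Set Ω}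
    (hΔ : Δ ∈ K.classes) {g : G.toSubgroup} (hg : ∀ x, g.1 x ∈ Δ ↔ x ∈ Δ) :
    ∃ d : G.toSubgroup, (∀ x ∈ Δ, d.1 x = g.1 x) ∧ ∀ x ∉ Δ, d.1 x = x := by
  obtain ⟨d, hd, h⟩ := hG Δ ⟨K, hK, hΔ⟩ g.1 g.2 (by
    ext y
    constructor
    · rintro ⟨x, hx, rfl⟩
      exact (hg x).2 hx
    · intro hy
      refine ⟨(g⁻¹).1 y, (hg _).1 ?_, act_inv_act _ _⟩
      rwa [act_inv_act])
  exact ⟨⟨d, hd⟩, h⟩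

/-- A class of a spine member has a second point; an element carrying `x` there stabilizes Δ, and
abundance cuts it off outside Δ. -/
theorem exists_moves (hG : G.Transitive) (hGa : G.Abundant) {K : Setoid Ω} (hK : K ∈ G.spine)
    {Δ : Set Ω} (hΔ : Δ ∈ K.classes) {x : Ω} (hx : x ∈ Δ) :
    ∃ k : G.toSubgroup, (∀ y ∉ Δ, k.1 y = y) ∧ k.1 x ≠ x := by
  obtain ⟨a, c, hac, rfl, ha, -⟩ := spine_class hG hK hΔ hx
  have hc : c ∈ Δ := (mem_class_iff hΔ ha _).2 (V_rel _ _)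
  obtain ⟨z, hz, hzx⟩ : ∃ z ∈ Δ, z ≠ x := by
    by_cases h : a = x
    · exact ⟨c, hc, h ▸ hac.ne'⟩
    · exact ⟨a, ha, h⟩
  obtain ⟨g, rfl⟩ := hG.exists_act x z
  obtain ⟨d, hd, hd'⟩ := hGa.exists_cut hK hΔ
    ((convexCong_of_mem_spine hK).act_mem_iff hΔ hx hz)
  exact ⟨d, hd', by rwa [hd x hx]⟩

/-! ### An element whose conjugates spread over a class -/

/-- `w` lies below `h a` for all `h` mapping `c` to `x`. -/
def FarBelow (G : LPermGroup Ω) (a c w x : Ω) : Prop :=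
  ∀ h : G.toSubgroup, h.1 c = x → w < h.1 a

/-- `n`-fold iteration of `FarBelow`. -/
def FarBelowIter (G : LPermGroup Ω) (a c : Ω) : ℕ → Ω → Ω → Prop
  | 0, w, x => w ≤ x
  | n + 1, w, x => ∃ y, G.FarBelow a c w y ∧ FarBelowIter G a c n y x

section FarBelow

variable {a c : Ω}

theorem FarBelow.anti_left {w w' x : Ω} (h : G.FarBelow a c w x) (hw : w' ≤ w) :
    G.FarBelow a c w' x := fun k hk => hw.trans_lt (h k hk)

theorem FarBelow.mono_right (hG : G.Transitive) {w x x' : Ω} (h : G.FarBelow a c w x)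
    (hx : x ≤ x') : G.FarBelow a c w x' := by
  intro k hk
  -- The meet of `k` with `m` sends `c` to the smaller point `x` and sends `a` no higher than `k`
  -- does.
  obtain ⟨m, hm⟩ := hG.exists_act c x
  have := h (k ⊓ m) (by rw [inf_act, hk, hm, min_eq_right hx])
  exact this.trans_le (min_le_left _ _)

/-- Transitivity supplies an element mapping `c` to `x`; without one, `FarBelow` would hold
vacuously. -/
theorem FarBelow.lt (hG : G.Transitive) (hac : a < c) {w x : Ω} (h : G.FarBelow a c w x) :
    w < x := by
  obtain ⟨m, rfl⟩ := hG.exists_act c x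
  exact (h m rfl).trans ((act_lt m).2 hac)

theorem FarBelow.act {w x : Ω} (h : G.FarBelow a c w x) (g : G.toSubgroup) :
    G.FarBelow a c (g.1 w) (g.1 x) := by
  intro k hk
  have := h (g⁻¹ * k) (by rw [mul_act, hk, inv_act_act])
  rwa [← act_lt g, mul_act, act_inv_act] at this

theorem FarBelowIter.anti_left {n : ℕ} {w w' x : Ω} (h : G.FarBelowIter a c n w x)
    (hw : w' ≤ w) : G.FarBelowIter a c n w' x := by
  cases n with
  | zero => exact hw.trans h
  | succ n =>
    obtain ⟨y, hy, h⟩ := h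
    exact ⟨y, hy.anti_left hw, h⟩

theorem FarBelowIter.mono_right {n : ℕ} {w x x' : Ω} (h : G.FarBelowIter a c n w x)
    (hx : x ≤ x') : G.FarBelowIter a c n w x' := by
  induction n generalizing w with
  | zero => exact le_trans h hx
  | succ n ih =>
    obtain ⟨y, hy, h⟩ := h
    exact ⟨y, hy, ih h⟩

theorem FarBelowIter.act {n : ℕ} {w x : Ω} (h : G.FarBelowIter a c n w x) (g : G.toSubgroup) :
    G.FarBelowIter a c n (g.1 w) (g.1 x) := by
  induction n generalizing w with
  | zero => exact (act_le g).2 h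
  | succ n ih =>
    obtain ⟨y, hy, h⟩ := h
    exact ⟨_, hy.act g, ih h⟩

theorem FarBelowIter.act_iff {n : ℕ} {w x : Ω} (g : G.toSubgroup) :
    G.FarBelowIter a c n (g.1 w) (g.1 x) ↔ G.FarBelowIter a c n w x :=
  ⟨fun h => by simpa only [inv_act_act] using h.act g⁻¹, fun h => h.act g⟩

/-- A chain of `n + m` steps has an intermediate point after `n` steps, and `y` lies on one side of
it. This gives transitivity of `farSetoid`. -/
theorem FarBelowIter.split {n m : ℕ} {x z : Ω} (h : G.FarBelowIter a c (n + m) x z) (y : Ω) :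
    G.FarBelowIter a c n x y ∨ G.FarBelowIter a c m y z := by
  induction n generalizing x with
  | zero =>
    rw [zero_add] at h
    exact (le_total x y).imp id fun hy => h.anti_left hy
  | succ n ih =>
    rw [Nat.succ_add] at h
    obtain ⟨w, hw, h⟩ := h
    exact (ih h).imp_left fun h => ⟨w, hw, h⟩

theorem FarBelowIter.snoc {n : ℕ} {w x z : Ω} (h : G.FarBelowIter a c n w x)
    (hz : G.FarBelow a c x z) : G.FarBelowIter a c (n + 1) w z := by
  induction n generalizing w with
  | zero => exact ⟨z, hz.anti_left h, le_refl z⟩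
  | succ n ih =>
    obtain ⟨y, hy, h⟩ := h
    exact ⟨y, hy, ih h⟩

theorem not_farBelowIter_one (hG : G.Transitive) (hac : a < c) {x y : Ω} (h : y ≤ x) :
    ¬ G.FarBelowIter a c 1 x y := by
  rintro ⟨z, hz, hzy⟩
  exact ((hz.lt hG hac).trans_le hzy).not_ge h

/-- Two points are related if neither is infinitely far below the other one. -/
def farSetoid (hG : G.Transitive) (hac : a < c) : Setoid Ω where
  r x y := (∃ n, ¬ G.FarBelowIter a c n x y) ∧ ∃ n, ¬ G.FarBelowIter a c n y x
  iseqv :=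
    { refl := fun _ => ⟨⟨1, not_farBelowIter_one hG hac le_rfl⟩,
        ⟨1, not_farBelowIter_one hG hac le_rfl⟩⟩
      symm := fun h => h.symm
      trans := by
        rintro x y z ⟨⟨n, hn⟩, m, hm⟩ ⟨⟨n', hn'⟩, m', hm'⟩
        exact ⟨⟨n + n', fun h => (h.split y).elim hn hn'⟩,
          ⟨m' + m, fun h => (h.split y).elim hm' hm⟩⟩ }

theorem farSetoid_convexCong (hG : G.Transitive) (hac : a < c) :
    G.ConvexCong (farSetoid hG hac) where
  invariant := by
    rintro g hg x y ⟨⟨n, hn⟩, m, hm⟩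
    refine ⟨⟨n, fun h => hn ?_⟩, m, fun h => hm ?_⟩
    · exact (FarBelowIter.act_iff ⟨g, hg⟩).1 h
    · exact (FarBelowIter.act_iff ⟨g, hg⟩).1 h
  convex := by
    rintro x y z hxy hyz ⟨⟨n, hn⟩, -⟩
    exact ⟨⟨n, fun h => hn (h.mono_right hyz)⟩, 1, not_farBelowIter_one hG hac hxy⟩

/-- If `a` were far below `c`, the identity, which fixes `c`, would give `a < a`. By minimality of
`V`, all of `V(a, c)` is then contained in `farSetoid`. -/
theorem farSetoid_rel (hG : G.Transitive) (hac : a < c) : farSetoid hG hac a c := by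
  refine ⟨⟨1, ?_⟩, 1, not_farBelowIter_one hG hac hac.le⟩
  rintro ⟨z, hz, hzc⟩
  exact lt_irrefl _ (hz.mono_right hG hzc 1 rfl)

/-- Either some element stabilizes the class of `a` modulo `V(a, c)` and moves all of its points,
or the stabilizer of `c` moves `a` arbitrarily far down in this class. -/
theorem exists_fixedPointFree_or (hG : G.Transitive) (hac : a < c) :
    (∃ k : G.toSubgroup, ∃ b, G.V a c a b ∧ G.V a c a (k.1 b) ∧ ∀ y, G.V a c a y → k.1 y ≠ y) ∨
      ∀ b, G.V a c a b → ∃ g : G.toSubgroup, g.1 c = c ∧ g.1 a ≤ b := by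
  refine or_iff_not_imp_right.2 fun h => ?_
  push Not at h
  obtain ⟨b, hb, hfar⟩ := h
  -- That no element fixing `c` takes `a` to `b` or lower is literally `FarBelow` for `b` and `c`.
  -- An element `k` with `k b = c` will be fixed-point free on the class.
  have hbc : G.FarBelow a c b c := hfar
  obtain ⟨k, hk⟩ := hG.exists_act b c
  refine ⟨k, b, hb, hk ▸ V_rel _ _, fun y hy hky => ?_⟩
  have hyb : farSetoid hG hac y b :=
    V_le (farSetoid_convexCong hG hac) (farSetoid_rel hG hac)
      (Setoid.trans' _ (Setoid.symm' _ hy) hb)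
  obtain ⟨⟨n, hn⟩, m, hm⟩ := hyb
  -- If `k` fixes `y ≥ b`, applying `k` to a chain from `b` to `y` gives one from `c` to `y`, which
  -- the step from `b` to `c` prolongs. So `b` is infinitely far below `y`, against `farSetoid`. For
  -- `y ≤ b` the chain is prolonged at its upper end and pulled back by `k⁻¹`.
  rcases le_total b y with hby | hby
  · refine hm ?_
    clear hm
    induction m with
    | zero => exact hby
    | succ m ih => exact ⟨c, hbc, by simpa only [hk, hky] using ih.act k⟩
  · refine hn ?_
    clear hn
    induction n with
    | zero => exact hby
    | succ n ih =>
      have h' : (k⁻¹).1 y = y := by rw [← act_inj k, act_inv_act, hky]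
      have h'' : (k⁻¹).1 c = b := by rw [← act_inj k, act_inv_act, hk]
      simpa only [h', h''] using (ih.snoc hbc).act k⁻¹

end FarBelow

theorem moves_of_mem_Icc {e : G.toSubgroup} {a x : Ω} (ha : a < e.1 a) (h₁ : a ≤ x)
    (h₂ : x ≤ e.1 a) : e.1 x ≠ x := by
  intro h
  have h₃ : e.1 a ≤ x := h ▸ (act_le e).2 h₁
  have h₄ : e.1 a = x := le_antisymm h₃ h₂
  exact ha.ne ((act_inj e).1 (h₄.trans h.symm) ▸ h₄.symm)

theorem not_orth_of_moves {g h : G.toSubgroup} {x : Ω} (h₁ : g.1 x ≠ x) (h₂ : h.1 x ≠ x) :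
    ¬ Orth g h := fun h => ((orth_iff _ _).1 h x).elim h₁ h₂

theorem conj_moves {g h : G.toSubgroup} {x : Ω} (hx : g.1 x ≠ x) :
    (h * g * h⁻¹).1 (h.1 x) ≠ h.1 x := by
  rwa [conj_act_act, Ne, act_inj]

/-- A fixed-point free element on the class does the job by itself. Otherwise an element moving all
of `[a, c]` is used, and the stabilizer of `c` stretches this interval as far as needed. -/
theorem exists_spread (hG : G.Transitive) (hGa : G.Abundant) {a c : Ω} (hac : a < c) :
    ∃ g : G.toSubgroup, (∀ x, ¬ G.V a c a x → g.1 x = x) ∧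
      ∀ y, G.V a c a y → ∃ h : G.toSubgroup,
        (h * g * h⁻¹).1 y ≠ y ∧ ¬ Orth (h * g * h⁻¹) g := by
  have hV : G.V a c ∈ G.spine := ⟨a, c, hac.ne, rfl⟩
  have hΔ := class_of (G.V a c) a
  have cut : ∀ k : G.toSubgroup, ∀ b, G.V a c a b → G.V a c a (k.1 b) →
      ∃ d : G.toSubgroup, (∀ x, G.V a c a x → d.1 x = k.1 x) ∧
        ∀ x, ¬ G.V a c a x → d.1 x = x := fun k b h h' =>
    hGa.exists_cut hV hΔ ((V_convexCong a c).act_mem_iff hΔ (x := b) h h')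
  rcases exists_fixedPointFree_or hG hac with ⟨k, b, hb, hkb, hk⟩ | hdown
  · obtain ⟨d, hd, hd'⟩ := cut k b hb hkb
    have hmov : ∀ y, G.V a c a y → d.1 y ≠ y := fun y hy => by
      rw [hd y hy]
      exact hk y hy
    refine ⟨d, hd', fun y hy => ⟨1, ?_, ?_⟩⟩
    · simpa using hmov y hy
    · simpa using not_orth_of_moves (hmov y hy) (hmov y hy)
  · obtain ⟨k, hk⟩ := hG.exists_act a c
    obtain ⟨e, he, he'⟩ := cut k a (Setoid.refl' _ _) (hk ▸ V_rel _ _)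
    have hea : e.1 a = c := (he a (Setoid.refl' _ _)).trans hk
    have hmov : ∀ x, a ≤ x → x ≤ c → e.1 x ≠ x := fun x h₁ h₂ =>
      moves_of_mem_Icc (hea ▸ hac) h₁ (hea ▸ h₂)
    refine ⟨e, he', fun y hy => ?_⟩
    rcases le_total y a with hya | hya
    · obtain ⟨g, hgc, hga⟩ := hdown y hy
      refine ⟨g, ?_, ?_⟩
      · have := conj_moves (h := g) (hmov ((g⁻¹).1 y) ?_ ?_)
        · rwa [act_inv_act] at this
        · rwa [← act_le g, act_inv_act]
        · rw [← act_le g, act_inv_act, hgc]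
          exact hya.trans hac.le
      · have := conj_moves (h := g) (hmov c hac.le le_rfl)
        rw [hgc] at this
        exact not_orth_of_moves this (hmov c hac.le le_rfl)
    · obtain ⟨h, hh⟩ : ∃ h : G.toSubgroup, h.1 y = c ∧ a ≤ h.1 a := by
        obtain ⟨h, hh⟩ := hG.exists_act y c
        have hha : G.V a c a (h.1 a) := by
          have : G.V a c (h.1 y) (h.1 a) :=
            ((V_convexCong a c).act h).2 (Setoid.symm' _ hy)
          rw [hh] at this
          exact Setoid.trans' _ (V_rel _ _) this
        obtain ⟨g, hgc, hga⟩ := hdown _ hha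
        refine ⟨g⁻¹ * h, ?_, ?_⟩
        · rw [mul_act, hh, ← act_inj g, act_inv_act, hgc]
        · rwa [mul_act, ← act_le g, act_inv_act]
      have hinv : ∀ x, (h⁻¹).1 (h.1 x) = x := inv_act_act h
      refine ⟨h⁻¹, ?_, ?_⟩
      · have := conj_moves (h := h⁻¹) (hmov (h.1 y) (hh.1 ▸ hac.le) hh.1.le)
        rwa [hinv] at this
      · have := conj_moves (h := h⁻¹) (hmov (h.1 a) hh.2 (hh.1 ▸ (act_le h).2 hya))
        rw [hinv] at this
        exact not_orth_of_moves this (hmov a le_rfl hac.le)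

/-! ### Sets represented by elements -/

/-- The hull of `g` consists of all elements supported in `B`, and these have no common fixed
point in `B`. -/
def Represents (G : LPermGroup Ω) (g : G.toSubgroup) (B : Set Ω) : Prop :=
  (∀ k : G.toSubgroup, InHull g k ↔ ∀ x ∉ B, k.1 x = x) ∧
    ∀ x ∈ B, ∃ k : G.toSubgroup, (∀ y ∉ B, k.1 y = y) ∧ k.1 x ≠ x

/-- Each point of `B` is moved by some element of the hull, so conjugating the hull translates `B`:
the normalizer is the setwise stabilizer of `B`. -/
theorem Represents.normalizes_iff {g : G.toSubgroup} {B : Set Ω} (hB : G.Represents g B)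
    (h : G.toSubgroup) : Normalizes g h ↔ ∀ x, h.1 x ∈ B ↔ x ∈ B := by
  constructor
  · intro hn x
    constructor
    · intro hx
      obtain ⟨k, hk, hkx⟩ := hB.2 _ hx
      have h₁ : InHull g (h⁻¹ * k * h) := by
        rw [hn, hB.1]
        simpa only [mul_assoc, mul_inv_cancel_left, mul_inv_cancel, mul_one] using hk
      by_contra hx'
      have := (hB.1 _).1 h₁ x hx'
      rw [mul_act, mul_act, ← act_inj h, act_inv_act] at this
      exact hkx this
    · intro hx
      obtain ⟨k, hk, hkx⟩ := hB.2 _ hx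
      by_contra hx'
      exact conj_moves hkx ((hB.1 _).1 ((hn k).1 ((hB.1 k).2 hk)) _ hx')
  · intro hn k
    rw [hB.1, hB.1]
    constructor
    · intro hk x hx
      rw [conj_act, hk, act_inv_act]
      rwa [← hn, act_inv_act]
    · intro hk x hx
      have := hk (h.1 x) (by rwa [hn])
      rwa [conj_act_act, act_inj] at this

theorem Represents.hullLT_iff {g g' : G.toSubgroup} {B B' : Set Ω} (hB : G.Represents g B)
    (hB' : G.Represents g' B') : HullLT g g' ↔ B ⊂ B' := by
  have key : ∀ {g g' : G.toSubgroup} {B B' : Set Ω}, G.Represents g B → G.Represents g' B' →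
      ((∀ k : G.toSubgroup, InHull g k → InHull g' k) ↔ B ⊆ B') := by
    intro g g' B B' hB hB'
    constructor
    · intro h x hx
      obtain ⟨k, hk, hkx⟩ := hB.2 x hx
      by_contra hx'
      exact hkx ((hB'.1 k).1 (h k ((hB.1 k).2 hk)) x hx')
    · intro h k hk
      rw [hB'.1]
      exact fun x hx => (hB.1 k).1 hk x fun h' => hx (h h')
  rw [HullLT, key hB hB', Set.ssubset_def, ← key hB' hB]
  push Not
  rfl

theorem conj_one_moves {g : G.toSubgroup} {h : G.toSubgroup} {x : Ω}
    (hx : (h * g * h⁻¹).1 x ≠ x) : g ≠ 1 := by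
  rintro rfl
  simp at hx

/-- A conjugate of `g` that meets `g` is supported in a translate of Δ meeting Δ, hence in Δ itself.
An element orthogonal to all these conjugates fixes Δ pointwise, by the spreading hypothesis. -/
theorem represents_of_spread (hG : G.Transitive) (hGa : G.Abundant) {K : Setoid Ω}
    (hK : K ∈ G.spine) {Δ : Set Ω} (hΔ : Δ ∈ K.classes) {g : G.toSubgroup}
    (hg : ∀ x ∉ Δ, g.1 x = x) (hs : ∀ y ∈ Δ, ∃ h : G.toSubgroup,
      (h * g * h⁻¹).1 y ≠ y ∧ ¬ Orth (h * g * h⁻¹) g) : G.Represents g Δ := by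
  have hC := convexCong_of_mem_spine hK
  refine ⟨fun k => ⟨fun hk x hx => ?_, fun hk f hf => ?_⟩, fun x hx => exists_moves hG hGa hK hΔ hx⟩
  · by_contra hkx
    -- This `f` lives on the class of `x`, which is disjoint from Δ. It is orthogonal to all
    -- conjugates in question but not to `k`.
    obtain ⟨f, hf, hfx⟩ := exists_moves hG hGa hK (class_of K x) (K.refl' x)
    refine not_orth_of_moves hfx hkx (hk f fun h hh => (orth_iff _ _).2 fun y => ?_)
    by_cases hy : K x y
    · right
      have hyΔ : y ∉ Δ := fun h => hx ((mem_class_iff hΔ h x).2 (K.symm' hy))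
      by_contra hyg
      rw [orth_iff] at hh
      push Not at hh
      obtain ⟨z, hz, hz'⟩ := hh
      have mem : ∀ w, (h * g * h⁻¹).1 w ≠ w → (h⁻¹).1 w ∈ Δ := by
        intro w hw
        by_contra hw'
        rw [conj_act, hg _ hw', act_inv_act] at hw
        exact hw rfl
      have hzΔ : z ∈ Δ := by
        by_contra h'
        exact hz' (hg z h')
      exact hyΔ ((hC.act_mem_iff hΔ hzΔ (mem z hz) y).1 (mem y hyg))
    · exact Or.inl (hf y hy)
  · rw [orth_iff]
    intro x
    by_cases hx : x ∈ Δ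
    · obtain ⟨h, hh, ho⟩ := hs x hx
      exact Or.inl (((orth_iff _ _).1 (hf h ho) x).resolve_right hh)
    · exact Or.inr (hk x hx)

/-- Translates of a class are equal or disjoint, and an element between `1` and a stabilizer of a
class keeps each point of the class inside it by convexity. -/
theorem Represents.isGood {g : G.toSubgroup} {C : Setoid Ω} (hC : G.ConvexCong C) {Δ : Set Ω}
    (hΔ : Δ ∈ C.classes) (hr : G.Represents g Δ) (hg : g ≠ 1) : IsGood g := by
  refine ⟨hg, fun h => ?_, fun h k hh hhk hk => ?_⟩
  · rw [hr.normalizes_iff]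
    refine or_iff_not_imp_right.2 fun ho => ?_
    push Not at ho
    obtain ⟨k, hk, l, hl, ho⟩ := ho
    rw [orth_iff] at ho
    push Not at ho
    obtain ⟨x, hx, hx'⟩ := ho
    have h₁ : x ∈ Δ := by
      by_contra h'
      exact hx ((hr.1 k).1 hk x h')
    have h₂ : (h⁻¹).1 x ∈ Δ := by
      by_contra h'
      rw [conj_act, (hr.1 l).1 hl _ h', act_inv_act] at hx'
      exact hx' rfl
    exact hC.act_mem_iff hΔ h₂ (by rwa [act_inv_act])
  · rw [hr.normalizes_iff] at hk ⊢
    obtain ⟨x, hx⟩ := class_nonempty hΔ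
    refine hC.act_mem_iff hΔ hx ?_
    rw [mem_class_iff hΔ hx]
    refine hC.convex _ _ (k.1 x) ?_ ?_ ((mem_class_iff hΔ hx _).1 ((hk x).2 hx))
    · rw [← hh]
      exact le_max_left _ _
    · rw [← hhk]
      exact le_max_left _ _

/-- Every member of the root system is represented by a good element. -/
theorem exists_represents (hG : G.Transitive) (hGa : G.Abundant) {K : Setoid Ω}
    (hK : K ∈ G.spine) {Δ : Set Ω} (hΔ : Δ ∈ K.classes) :
    ∃ g : G.toSubgroup, IsGood g ∧ G.Represents g Δ := by
  obtain ⟨x, hx⟩ := class_nonempty hΔ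
  obtain ⟨a, c, hac, rfl, ha, -⟩ := spine_class hG hK hΔ hx
  obtain ⟨g, hg, hs⟩ := exists_spread hG hGa hac
  have hr : G.Represents g Δ := represents_of_spread hG hGa hK hΔ
    (fun x hx => hg x (by rwa [← mem_class_iff hΔ ha]))
    (fun y hy => hs y (by rwa [← mem_class_iff hΔ ha]))
  obtain ⟨h, hh, -⟩ := hs a (Setoid.refl' _ _)
  exact ⟨g, hr.isGood (convexCong_of_mem_spine hK) hΔ (conj_one_moves hh), hr⟩

/-- Every good element represents a class of a non-trivial convex congruence. -/
theorem exists_convexCong_of_isGood (hG : G.Transitive) {g : G.toSubgroup} (hg : IsGood g) :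
    ∃ C : Setoid Ω, G.ConvexCong C ∧ C ≠ ⊥ ∧ ∃ B ∈ C.classes, G.Represents g B := by
  -- The union of the supports of the hull. As the hull is a polar, it contains every element
  -- supported in this union.
  set B : Set Ω := {x | ∃ k : G.toSubgroup, InHull g k ∧ k.1 x ≠ x} with hBdef
  have hull : ∀ k : G.toSubgroup, InHull g k ↔ ∀ x ∉ B, k.1 x = x := by
    refine fun k => ⟨fun hk x hx => ?_, fun hk f hf => (orth_iff _ _).2 fun x => ?_⟩
    · by_contra h
      exact hx ⟨k, hk, h⟩
    · by_cases hx : x ∈ B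
      · obtain ⟨l, hl, hlx⟩ := hx
        exact Or.inl (((orth_iff _ _).1 (hl f hf) x).resolve_right hlx)
      · exact Or.inr (hk x hx)
  have hr : G.Represents g B := by
    refine ⟨hull, ?_⟩
    rintro x ⟨k, hk, hkx⟩
    exact ⟨k, (hull k).1 hk, hkx⟩
  have hgood := hg
  obtain ⟨hg1, hblock, hconv⟩ := hgood
  -- The second condition of `IsGood` makes `B` a block: overlapping translates yield non-orthogonal
  -- elements of the hull and its conjugate, so `h` must normalize the hull.
  have block : ∀ (h : G.toSubgroup) (x : Ω), x ∈ B → h.1 x ∈ B → ∀ y, h.1 y ∈ B ↔ y ∈ B := by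
    rintro h x ⟨l, hl, hlx⟩ ⟨k, hk, hkx⟩
    rcases hblock h with hn | ho
    · exact (hr.normalizes_iff h).1 hn
    · exact absurd (ho k hk l hl) (not_orth_of_moves hkx (conj_moves hlx))
  obtain ⟨α, hα⟩ : ∃ α, g.1 α ≠ α := by
    by_contra! h
    exact hg1 (ext_act h)
  have hgg : InHull g g := fun f hf => by
    have := hf 1
    simp only [one_mul, inv_one, mul_one] at this
    exact this (not_orth_of_moves hα hα)
  have hαB : α ∈ B := ⟨g, hgg, hα⟩
  have hgαB : g.1 α ∈ B := ⟨g, hgg, fun h => hα ((act_inj g).1 h)⟩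
  have convex : ∀ x y z, x ≤ y → y ≤ z → x ∈ B → z ∈ B → y ∈ B := by
    intro x y z hxy hyz hx hz
    obtain ⟨k, hk⟩ := hG.exists_act x z
    obtain ⟨h, hh⟩ := hG.exists_act x y
    have hkx : (1 ⊔ k).1 x = z := by rw [sup_act, one_act, hk, max_eq_right (hxy.trans hyz)]
    -- This element takes `x` to `y` and lies between `1` and `1 ⊔ k`, which stabilizes `B`; the
    -- third condition of `IsGood` applies.
    have hhx : ((1 ⊔ h) ⊓ (1 ⊔ k)).1 x = y := by
      rw [inf_act, hkx, sup_act, one_act, hh, max_eq_right hxy, min_eq_left hyz]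
    have := (hr.normalizes_iff _).1 (hconv ((1 ⊔ h) ⊓ (1 ⊔ k)) (1 ⊔ k)
      (sup_eq_right.2 (le_inf le_sup_left le_sup_left)) (sup_eq_right.2 inf_le_right)
      ((hr.normalizes_iff _).2 (block _ x hx (by rwa [hkx])))) x
    rw [hhx] at this
    exact this.2 hx
  -- The classes are the translates of `B`, which cover Ω by transitivity.
  let C : Setoid Ω :=
    { r := fun x y => ∃ h : G.toSubgroup, h.1 x ∈ B ∧ h.1 y ∈ B
      iseqv :=
        { refl := fun x => by
            obtain ⟨h, hh⟩ := hG.exists_act x α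
            exact ⟨h, hh ▸ hαB, hh ▸ hαB⟩
          symm := fun ⟨h, h₁, h₂⟩ => ⟨h, h₂, h₁⟩
          trans := by
            rintro x y z ⟨h, h₁, h₂⟩ ⟨k, k₁, k₂⟩
            refine ⟨h, h₁, ?_⟩
            have := (block (h * k⁻¹) (k.1 y) k₁ (by rwa [mul_act, inv_act_act]) (k.1 z)).2 k₂
            rwa [mul_act, inv_act_act] at this } }
  refine ⟨C, ⟨?_, ?_⟩, ?_, B, ⟨α, ?_⟩, hr⟩
  · rintro k hk x y ⟨h, h₁, h₂⟩
    refine ⟨h * (⟨k, hk⟩ : G.toSubgroup)⁻¹, ?_, ?_⟩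
    · rw [mul_act]
      exact (inv_act_act (⟨k, hk⟩ : G.toSubgroup) x).symm ▸ h₁
    · rw [mul_act]
      exact (inv_act_act (⟨k, hk⟩ : G.toSubgroup) y).symm ▸ h₂
  · rintro x y z hxy hyz ⟨h, h₁, h₂⟩
    exact ⟨h, h₁, convex _ _ _ ((act_le h).2 hxy) ((act_le h).2 hyz) h₁ h₂⟩
  · intro hbot
    have : C α (g.1 α) := ⟨1, hαB, hgαB⟩
    rw [hbot] at this
    exact hα this.symm
  · ext y
    constructor
    · exact fun hy => ⟨1, hy, hαB⟩
    · rintro ⟨h, h₁, h₂⟩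
      exact (block h α hαB h₂ y).1 h₁

/-! ### Chains in the spine -/

/-- Let `C`, but not `C'`, relate `a < b`. Any `C'`-related pair `x < y` can be moved to start at
`a`; it must then end before `b`, or convexity would make `C'` relate `a` and `b`. Convexity of `C`
finishes. -/
theorem convexCong_total (hG : G.Transitive) {C C' : Setoid Ω} (hC : G.ConvexCong C)
    (hC' : G.ConvexCong C') : C ≤ C' ∨ C' ≤ C := by
  refine or_iff_not_imp_left.2 fun h => ?_
  obtain ⟨a, b, hab, hCab, hC'ab⟩ : ∃ a b, a < b ∧ C a b ∧ ¬ C' a b := by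
    by_contra! hn
    refine h fun x y hxy => ?_
    rcases lt_trichotomy x y with hlt | rfl | hlt
    · exact hn _ _ hlt hxy
    · exact C'.refl' _
    · exact C'.symm' (hn _ _ hlt (C.symm' hxy))
  have key : ∀ x y, x < y → C' x y → C x y := by
    intro x y hlt hxy
    obtain ⟨g, hg⟩ := hG.exists_act x a
    rw [← hC.act g, hg]
    rw [← hC'.act g, hg] at hxy
    have hay : a ≤ g.1 y := by rw [← hg, act_le]; exact hlt.le
    refine hC.convex _ _ b hay ?_ hCab
    by_contra! hby
    exact hC'ab (hC'.convex _ _ _ hab.le hby.le hxy)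
  intro x y hxy
  rcases lt_trichotomy x y with hlt | rfl | hlt
  · exact key _ _ hlt hxy
  · exact C.refl' _
  · exact C.symm' (key _ _ hlt (C'.symm' hxy))

theorem exists_act_mem_iff (hG : G.Transitive) {C : Setoid Ω} (hC : G.ConvexCong C)
    {B B' : Set Ω} (hB : B ∈ C.classes) (hB' : B' ∈ C.classes) :
    ∃ h : G.toSubgroup, ∀ x, h.1 x ∈ B' ↔ x ∈ B := by
  obtain ⟨a, ha⟩ := class_nonempty hB
  obtain ⟨b, hb⟩ := class_nonempty hB'
  obtain ⟨h, hh⟩ := hG.exists_act a b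
  refine ⟨h, fun x => ?_⟩
  rw [mem_class_iff hB' hb, mem_class_iff hB ha, ← hh, hC.act]

theorem lt_of_class_ssubset (hG : G.Transitive) {C C' : Setoid Ω} (hC : G.ConvexCong C)
    (hC' : G.ConvexCong C') {B B' : Set Ω} (hB : B ∈ C.classes) (hB' : B' ∈ C'.classes)
    (h : B ⊂ B') : C < C' := by
  obtain ⟨b, hb⟩ := class_nonempty hB
  refine lt_of_le_of_ne (fun x y hxy => ?_) ?_
  · obtain ⟨g, hg⟩ := hG.exists_act x b
    rw [← hC.act g, hg] at hxy
    rw [← hC'.act g, hg, ← mem_class_iff hB' (h.1 hb)]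
    exact h.1 ((mem_class_iff hB hb _).2 hxy)
  · rintro rfl
    exact h.ne (C.eq_of_mem_classes hB hb hB' (h.1 hb))

theorem class_ssubset_of_lt (hG : G.Transitive) {C C' : Setoid Ω} (hC : G.ConvexCong C)
    (hC' : G.ConvexCong C') {B' : Set Ω} (hB' : B' ∈ C'.classes) (h : C < C') {x : Ω}
    (hx : x ∈ B') : {y | C x y} ⊂ B' := by
  refine Set.ssubset_iff_subset_ne.2 ⟨fun y hy => (mem_class_iff hB' hx y).2 (h.le hy), ?_⟩
  rintro rfl
  refine h.not_ge fun y z hyz => ?_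
  obtain ⟨g, hg⟩ := hG.exists_act y x
  rw [← hC.act g, hg]
  rw [← hC'.act g, hg] at hyz
  exact (mem_class_iff hB' hx _).2 hyz

/-! ### Levels of good elements and finite spines -/

section Chain

variable {m : ℕ} {K : Fin m → Setoid Ω}

/-- Classes through one point of Δ provide the chain. The family `K` need not exhaust the spine, so
this also applies to finite parts of an infinite spine. -/
theorem hasChain_of_le (hG : G.Transitive) (hGa : G.Abundant) (hK : StrictMono K)
    (hKG : ∀ i, K i ∈ G.spine) {n : ℕ} {i : Fin m} (hn : n ≤ i) {Δ : Set Ω}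
    (hΔ : Δ ∈ (K i).classes) {g : G.toSubgroup} (hg : IsGood g) (hr : G.Represents g Δ) :
    HasChain n g := by
  induction n generalizing i Δ g with
  | zero => exact hg
  | succ n ih =>
    obtain ⟨x, hx⟩ := class_nonempty hΔ
    let j : Fin m := ⟨n, by omega⟩
    have hj : K j < K i := hK (Fin.lt_def.2 hn)
    obtain ⟨g', hg', hr'⟩ := exists_represents hG hGa (hKG j) (class_of (K j) x)
    refine ⟨hg, g', ih (i := j) le_rfl (class_of _ x) hg' hr', (hr'.hullLT_iff hr).2 ?_⟩
    exact class_ssubset_of_lt hG (convexCong_of_mem_spine (hKG j))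
      (convexCong_of_mem_spine (hKG i)) hΔ hj hx

/-- If the spine is finite, it contains all non-trivial convex congruences. -/
theorem exists_eq_of_convexCong (hK : StrictMono K) (hKG : Set.range K = G.spine)
    {C : Setoid Ω} (hC : G.ConvexCong C) (hC' : C ≠ ⊥) : ∃ i, C = K i := by
  classical
  have hV : ∀ x y, x ≠ y → ∃ i, K i = G.V x y := fun x y h => by
    have : G.V x y ∈ Set.range K := hKG ▸ ⟨x, y, h, rfl⟩
    exact this
  -- A non-trivial `C` is the union of the `V x y` over its related pairs `x ≠ y`; among finitely
  -- many of these in a chain, one is largest.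
  let S : Finset (Fin m) := Finset.univ.filter fun i => ∃ x y, x ≠ y ∧ C x y ∧ K i = G.V x y
  have hS : S.Nonempty := by
    by_contra hn
    refine hC' (le_bot_iff.1 fun x y hxy => ?_)
    by_contra h
    obtain ⟨i, hi⟩ := hV x y h
    exact hn ⟨i, Finset.mem_filter.2 ⟨Finset.mem_univ _, x, y, h, hxy, hi⟩⟩
  obtain ⟨i, hi, hmax⟩ := S.exists_max_image id hS
  obtain ⟨-, x, y, -, hxy, hi⟩ := Finset.mem_filter.1 hi
  refine ⟨i, le_antisymm (fun z w hzw => ?_) (hi ▸ V_le hC hxy)⟩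
  by_cases h : z = w
  · exact h ▸ (K i).refl' z
  · obtain ⟨j, hj⟩ := hV z w h
    have : j ≤ i := hmax j (Finset.mem_filter.2 ⟨Finset.mem_univ _, z, w, h, hzw, hj⟩)
    exact hK.monotone this (hj ▸ V_rel z w)

theorem exists_class_of_isGood (hG : G.Transitive) (hK : StrictMono K)
    (hKG : Set.range K = G.spine) {g : G.toSubgroup} (hg : IsGood g) :
    ∃ i, ∃ Δ ∈ (K i).classes, G.Represents g Δ := by
  obtain ⟨C, hC, hC', B, hB, hr⟩ := exists_convexCong_of_isGood hG hg
  obtain ⟨i, rfl⟩ := exists_eq_of_convexCong hK hKG hC hC'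
  exact ⟨i, B, hB, hr⟩

variable (hG : G.Transitive) (hGa : G.Abundant) (hK : StrictMono K)
  (hKG : Set.range K = G.spine)

include hG hGa hK hKG

/-- Every good hull strictly inside that of `g` represents a class of some `K j` with `j < i`, so
each step down a chain lowers the index. -/
theorem hasChain_iff {n : ℕ} {i : Fin m} {Δ : Set Ω} (hΔ : Δ ∈ (K i).classes)
    {g : G.toSubgroup} (hg : IsGood g) (hr : G.Represents g Δ) : HasChain n g ↔ n ≤ i := by
  have hmem : ∀ i, K i ∈ G.spine := fun i => hKG ▸ Set.mem_range_self i
  refine ⟨fun h => ?_, fun h => hasChain_of_le hG hGa hK hmem h hΔ hg hr⟩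
  induction n generalizing i Δ g with
  | zero => exact Nat.zero_le _
  | succ n ih =>
    obtain ⟨-, g', h', hlt⟩ := h
    obtain ⟨j, Δ', hΔ', hr'⟩ := exists_class_of_isGood hG hK hKG h'.isGood
    have hji : K j < K i := lt_of_class_ssubset hG (convexCong_of_mem_spine (hmem j))
      (convexCong_of_mem_spine (hmem i)) hΔ' hΔ ((hr'.hullLT_iff hr).1 hlt)
    exact (ih hΔ' h'.isGood hr' h').trans_lt (Fin.lt_def.1 (hK.lt_iff_lt.1 hji))

theorem exists_hasChain_iff (n : ℕ) : (∃ g : G.toSubgroup, HasChain n g) ↔ n < m := by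
  have hmem : ∀ i, K i ∈ G.spine := fun i => hKG ▸ Set.mem_range_self i
  constructor
  · rintro ⟨g, hg⟩
    obtain ⟨i, Δ, hΔ, hr⟩ := exists_class_of_isGood hG hK hKG hg.isGood
    exact ((hasChain_iff hG hGa hK hKG hΔ hg.isGood hr).1 hg).trans_lt i.2
  · intro h
    obtain ⟨x, -⟩ := hmem ⟨n, h⟩
    obtain ⟨g, hg, hr⟩ := exists_represents hG hGa (hmem ⟨n, h⟩) (class_of _ x)
    exact ⟨g, (hasChain_iff hG hGa hK hKG (class_of _ x) hg hr).2 le_rfl⟩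

/-- For `i > 0` the congruence below `K i` is its predecessor, and the condition is that `z`
stabilizes each predecessor class inside Δ. For `i = 0` it is equality, and `z` must be trivial. -/
theorem inKer_iff {i : Fin m} {Δ : Set Ω} (hΔ : Δ ∈ (K i).classes) {g : G.toSubgroup}
    (hr : G.Represents g Δ) {z : G.toSubgroup} (hz : ∀ x ∉ Δ, z.1 x = x) :
    InKer i g z ↔ ∀ x ∈ Δ, G.below (K i) (z.1 x) x := by
  have hmem : ∀ i, K i ∈ G.spine := fun i => hKG ▸ Set.mem_range_self i
  obtain ⟨i, hi⟩ := i
  cases i with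
  | zero =>
    have hb : G.below (K ⟨0, hi⟩) = ⊥ := by
      refine le_bot_iff.1 (sSup_le ?_)
      rintro C ⟨hC, hlt⟩
      by_contra hne
      obtain ⟨j, rfl⟩ := exists_eq_of_convexCong hK hKG hC fun h => hne h.le
      exact absurd (hK.lt_iff_lt.1 hlt) (by simp [Fin.lt_def])
    rw [hb]
    constructor
    · rintro rfl x -
      exact Setoid.refl' _ x
    · intro h
      refine ext_act fun x => ?_
      by_cases hx : x ∈ Δ
      · exact h x hx
      · exact hz x hx
  | succ n =>
    let j : Fin m := ⟨n, by omega⟩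
    have hji : K j < K ⟨n + 1, hi⟩ := hK (Fin.lt_def.2 n.lt_succ_self)
    have hCj := convexCong_of_mem_spine (hmem j)
    have hCi := convexCong_of_mem_spine (hmem ⟨n + 1, hi⟩)
    have hb : G.below (K ⟨n + 1, hi⟩) = K j := by
      refine le_antisymm (sSup_le ?_) (le_sSup ⟨hCj, hji⟩)
      rintro C ⟨hC, hlt⟩
      by_cases hne : C = ⊥
      · exact hne ▸ bot_le
      · obtain ⟨l, rfl⟩ := exists_eq_of_convexCong hK hKG hC hne
        exact hK.monotone (Fin.le_def.2 (Nat.lt_succ_iff.1 (Fin.lt_def.1 (hK.lt_iff_lt.1 hlt))))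
    rw [hb]
    constructor
    · intro h x hx
      obtain ⟨g', hg', hr'⟩ := exists_represents hG hGa (hmem j) (class_of (K j) x)
      have hn := h g' ((hasChain_iff hG hGa hK hKG (class_of _ x) hg' hr').2 le_rfl)
        ((hr'.hullLT_iff hr).2 (class_ssubset_of_lt hG hCj hCi hΔ hji hx))
      exact (K j).symm' (((hr'.normalizes_iff z).1 hn x).2 ((K j).refl' x))
    · intro h g' hg' hlt
      obtain ⟨l, B, hB, hr'⟩ := exists_class_of_isGood hG hK hKG hg'.isGood
      have hss := (hr'.hullLT_iff hr).1 hlt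
      -- A chain of `n` hulls below `g'` gives `n ≤ l`, and lying strictly inside Δ gives `l < n +
      -- 1`.
      have hl : l = j := by
        have h₁ := (hasChain_iff hG hGa hK hKG hB hg'.isGood hr').1 hg'
        have h₂ := Fin.lt_def.1 (hK.lt_iff_lt.1
          (lt_of_class_ssubset hG (convexCong_of_mem_spine (hmem l)) hCi hB hΔ hss))
        exact Fin.ext (le_antisymm (Nat.lt_succ_iff.1 h₂) h₁)
      subst hl
      obtain ⟨x, hx⟩ := class_nonempty hB
      exact (hr'.normalizes_iff z).2 (hCj.act_mem_iff hB hx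
        ((mem_class_iff hB hx _).2 ((K j).symm' (h x (hss.1 hx)))))

end Chain

/-- If the length of chains of hulls is bounded, then the spine is finite. -/
theorem exists_enumeration_spine (hG : G.Transitive) (hGa : G.Abundant) {n : ℕ}
    (hn : ¬ ∃ g : G.toSubgroup, HasChain n g) :
    ∃ (m : ℕ) (K : Fin m → Setoid Ω), StrictMono K ∧ Set.range K = G.spine := by
  classical
  let _ : LinearOrder G.spine :=
    { (inferInstance : PartialOrder G.spine) with
      le_total := fun a b => convexCong_total hG (convexCong_of_mem_spine a.2)
        (convexCong_of_mem_spine b.2)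
      toDecidableLE := Classical.decRel _ }
  rcases finite_or_infinite G.spine with hf | hf
  · have := Fintype.ofFinite G.spine
    let e := Fintype.orderIsoFinOfCardEq G.spine rfl
    refine ⟨_, fun i => (e i).1, fun i j hij => e.strictMono hij, ?_⟩
    ext C
    exact ⟨fun ⟨i, hi⟩ => hi ▸ (e i).2,
      fun hC => ⟨e.symm ⟨C, hC⟩, congrArg Subtype.val (e.apply_symm_apply ⟨C, hC⟩)⟩⟩
  -- Among `n + 1` members of the spine the largest has `n` below it, so an element representing one
  -- of its classes has a chain of length `n`.
  · obtain ⟨s, hs⟩ := Infinite.exists_subset_card_eq G.spine (n + 1)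
    let e := s.orderEmbOfFin hs
    obtain ⟨x, -⟩ := (e 0).2
    obtain ⟨g, hg, hr⟩ := exists_represents hG hGa (e (Fin.last n)).2 (class_of _ x)
    exact absurd ⟨g, hasChain_of_le hG hGa (K := fun i => (e i).1)
      (fun i j hij => e.strictMono hij) (fun i => (e i).2) le_rfl (class_of _ x) hg hr⟩ hn

/-! ### Components -/

section Component

variable {K : Setoid Ω} {Δ : Set Ω}

theorem Blocks.mk_eq_iff (x y : Δ) :
    Blocks.mk G K Δ x = Blocks.mk G K Δ y ↔ G.below K (x : Ω) (y : Ω) :=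
  Quotient.eq

theorem Blocks.exists_mk (b : G.Blocks K Δ) : ∃ x, Blocks.mk G K Δ x = b :=
  Quotient.exists_rep b

theorem Induces.unique {g : Ω ≃o Ω} {e f : G.Blocks K Δ ≃o G.Blocks K Δ}
    (he : G.Induces K Δ g e) (hf : G.Induces K Δ g f) : e = f := by
  refine OrderIso.ext (funext fun b => ?_)
  obtain ⟨x, rfl⟩ := Blocks.exists_mk b
  rw [he.2, hf.2]

theorem Induces.one : G.Induces K Δ 1 1 := ⟨fun _ => Iff.rfl, fun _ => rfl⟩

theorem Induces.mul {g k : Ω ≃o Ω} {e f : G.Blocks K Δ ≃o G.Blocks K Δ}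
    (he : G.Induces K Δ g e) (hf : G.Induces K Δ k f) : G.Induces K Δ (g * k) (e * f) := by
  refine ⟨fun x => (he.1 (k x)).trans (hf.1 x), fun x => ?_⟩
  change e (f _) = _
  rw [hf.2, he.2]
  rfl

theorem Induces.inv {g : Ω ≃o Ω} {e : G.Blocks K Δ ≃o G.Blocks K Δ}
    (he : G.Induces K Δ g e) : G.Induces K Δ g⁻¹ e⁻¹ := by
  refine ⟨fun x => ?_, fun x => ?_⟩
  · rw [← he.1]
    exact iff_of_eq (congrArg (· ∈ Δ) (g.apply_symm_apply x))
  · change e.symm _ = _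
    rw [OrderIso.symm_apply_eq, he.2]
    congr 1
    exact Subtype.ext (g.apply_symm_apply _).symm

theorem Induces.sup {g k : Ω ≃o Ω} {e f : G.Blocks K Δ ≃o G.Blocks K Δ}
    (he : G.Induces K Δ g e) (hf : G.Induces K Δ k f) : G.Induces K Δ (g ⊔ k) (e ⊔ f) := by
  refine ⟨fun x => ?_, fun x => ?_⟩
  · rw [aut_sup_apply]
    rcases max_choice (g x) (k x) with h | h <;> rw [h]
    · exact he.1 x
    · exact hf.1 x
  · rw [aut_sup_apply, he.2, hf.2, ← (Blocks.mk_mono G K Δ).map_max]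
    congr 1

theorem Induces.inf {g k : Ω ≃o Ω} {e f : G.Blocks K Δ ≃o G.Blocks K Δ}
    (he : G.Induces K Δ g e) (hf : G.Induces K Δ k f) : G.Induces K Δ (g ⊓ k) (e ⊓ f) := by
  refine ⟨fun x => ?_, fun x => ?_⟩
  · rw [aut_inf_apply]
    rcases min_choice (g x) (k x) with h | h <;> rw [h]
    · exact he.1 x
    · exact hf.1 x
  · rw [aut_inf_apply, he.2, hf.2, ← (Blocks.mk_mono G K Δ).map_min]
    congr 1

theorem exists_induces (hb : G.ConvexCong (G.below K)) {g : G.toSubgroup}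
    (hg : ∀ x, g.1 x ∈ Δ ↔ x ∈ Δ) : ∃ e, G.Induces K Δ g.1 e := by
  have main : ∀ g : G.toSubgroup, (∀ x, g.1 x ∈ Δ ↔ x ∈ Δ) →
      ∃ f : G.Blocks K Δ → G.Blocks K Δ, Monotone f ∧ ∀ (x y : Δ), g.1 x = y →
        f (Blocks.mk G K Δ x) = Blocks.mk G K Δ y := by
    intro g hg
    let f : G.Blocks K Δ → G.Blocks K Δ :=
      Quotient.lift (fun x : Δ => Blocks.mk G K Δ ⟨g.1 x, (hg x).2 x.2⟩)
        fun x y h => (Blocks.mk_eq_iff _ _).2 ((hb.act g).2 h)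
    have hf : ∀ x : Δ, f (Blocks.mk G K Δ x) = Blocks.mk G K Δ ⟨g.1 x, (hg x).2 x.2⟩ :=
      fun _ => rfl
    refine ⟨f, fun a b hab => ?_, ?_⟩
    · obtain ⟨x, rfl⟩ := Blocks.exists_mk a
      obtain ⟨y, rfl⟩ := Blocks.exists_mk b
      rcases le_total x y with h | h
      · rw [hf, hf]
        exact Blocks.mk_mono G K Δ ((act_le g).2 h)
      -- Here `y ≤ x` although the block of `x` is at most that of `y`, so the two blocks coincide.
      · rw [le_antisymm hab (Blocks.mk_mono G K Δ h)]
    · rintro x ⟨y, hy⟩ rfl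
      exact hf x
  have hg' : ∀ x, (g⁻¹).1 x ∈ Δ ↔ x ∈ Δ := fun x => by rw [← hg, act_inv_act]
  obtain ⟨f, hf, hf'⟩ := main g hg
  obtain ⟨k, hk, hk'⟩ := main g⁻¹ hg'
  let E : G.Blocks K Δ ≃ G.Blocks K Δ :=
    { toFun := f
      invFun := k
      left_inv := fun b => by
        obtain ⟨x, rfl⟩ := Blocks.exists_mk b
        rw [hf' x ⟨g.1 x, (hg x).2 x.2⟩ rfl, hk' _ x (inv_act_act g x)]
      right_inv := fun b => by
        obtain ⟨x, rfl⟩ := Blocks.exists_mk b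
        rw [hk' x ⟨(g⁻¹).1 x, (hg' x).2 x.2⟩ rfl, hf' _ x (act_inv_act g x)] }
  exact ⟨E.toOrderIso hf hk, hg, fun x => hf' x _ rfl⟩

theorem mem_iff_of_supported {z : G.toSubgroup} (hz : ∀ x ∉ Δ, z.1 x = x) (x : Ω) :
    z.1 x ∈ Δ ↔ x ∈ Δ := by
  by_cases hx : x ∈ Δ
  · refine iff_of_true ?_ hx
    by_contra h
    have := (act_inj z).1 (hz _ h)
    rw [this] at h
    exact h hx
  · rw [hz x hx]

/-- The component at `Δ` is a quotient of the group of elements supported in `Δ`. -/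
theorem exists_isQuotient (hGa : G.Abundant) (hK : K ∈ G.spine) (hΔ : Δ ∈ K.classes)
    (hb : G.ConvexCong (G.below K)) {N : G.toSubgroup → Prop}
    (hN : ∀ z : G.toSubgroup, (∀ x ∉ Δ, z.1 x = x) → (N z ↔ ∀ x ∈ Δ, G.below K (z.1 x) x)) :
    ∃ ρ : G.toSubgroup → (G.component K Δ).toSubgroup,
      IsQuotient (fun z => ∀ x ∉ Δ, z.1 x = x) N ρ := by
  classical
  -- Elements not supported in Δ receive the junk value `1`.
  have hex : ∀ z : G.toSubgroup, ∃ q : (G.component K Δ).toSubgroup,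
      (∀ x ∉ Δ, z.1 x = x) → G.Induces K Δ z.1 q.1 := by
    intro z
    by_cases hz : ∀ x ∉ Δ, z.1 x = x
    · obtain ⟨e, he⟩ := exists_induces (K := K) hb (mem_iff_of_supported hz)
      exact ⟨⟨e, z.1, z.2, he⟩, fun _ => he⟩
    · exact ⟨1, fun h => absurd h hz⟩
  choose ρ hρ using hex
  have hone : ∀ x ∉ Δ, (1 : G.toSubgroup).1 x = x := fun _ _ => rfl
  have hinv : ∀ z : G.toSubgroup, (∀ x ∉ Δ, z.1 x = x) → ∀ x ∉ Δ, (z⁻¹).1 x = x :=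
    fun z hz x hx => by rw [← act_inj z, act_inv_act, hz x hx]
  have hmul : ∀ z w : G.toSubgroup, (∀ x ∉ Δ, z.1 x = x) → (∀ x ∉ Δ, w.1 x = x) →
      ∀ x ∉ Δ, (z * w).1 x = x := fun z w hz hw x hx => by rw [mul_act, hw x hx, hz x hx]
  have hsup : ∀ z w : G.toSubgroup, (∀ x ∉ Δ, z.1 x = x) → (∀ x ∉ Δ, w.1 x = x) →
      ∀ x ∉ Δ, (z ⊔ w).1 x = x := fun z w hz hw x hx => by
    rw [sup_act, hw x hx, hz x hx, max_self]
  have hinf : ∀ z w : G.toSubgroup, (∀ x ∉ Δ, z.1 x = x) → (∀ x ∉ Δ, w.1 x = x) →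
      ∀ x ∉ Δ, (z ⊓ w).1 x = x := fun z w hz hw x hx => by
    rw [inf_act, hw x hx, hz x hx, min_self]
  refine ⟨ρ, hone, hinv, hmul, hsup, hinf, ?_, ?_, ?_, ?_, ?_, ?_, ?_⟩
  · exact Subtype.ext ((hρ 1 hone).unique Induces.one)
  · exact fun z hz => Subtype.ext ((hρ _ (hinv z hz)).unique (hρ z hz).inv)
  · exact fun z w hz hw => Subtype.ext ((hρ _ (hmul z w hz hw)).unique ((hρ z hz).mul (hρ w hw)))
  · exact fun z w hz hw => Subtype.ext ((hρ _ (hsup z w hz hw)).unique ((hρ z hz).sup (hρ w hw)))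
  · exact fun z w hz hw => Subtype.ext ((hρ _ (hinf z w hz hw)).unique ((hρ z hz).inf (hρ w hw)))
  -- Surjectivity is where abundance enters: an element inducing `e` is cut off outside Δ without
  -- changing its action on Δ.
  · rintro ⟨e, g, hg, he⟩
    obtain ⟨d, hd, hd'⟩ := hGa.exists_cut hK hΔ (g := ⟨g, hg⟩) he.1
    refine ⟨d, hd', Subtype.ext ((hρ d hd').unique ?_)⟩
    refine ⟨mem_iff_of_supported hd', fun x => ?_⟩
    rw [he.2]
    exact congrArg _ (Subtype.ext (hd x x.2).symm)
  · intro z w hz hw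
    rw [hN _ (hmul _ _ hz (hinv w hw))]
    have : ρ z = ρ w ↔ ∀ x ∈ Δ, G.below K (z.1 x) (w.1 x) := by
      constructor
      · intro h x hx
        have h₁ := (hρ z hz).2 ⟨x, hx⟩
        rw [h, (hρ w hw).2] at h₁
        exact Setoid.symm' _ ((Blocks.mk_eq_iff _ _).1 h₁)
      · refine fun h => Subtype.ext (OrderIso.ext (funext fun b => ?_))
        obtain ⟨x, rfl⟩ := Blocks.exists_mk b
        rw [(hρ z hz).2, (hρ w hw).2, Blocks.mk_eq_iff]
        exact h x x.2
    rw [this]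
    constructor
    · intro h x hx
      have := h ((w⁻¹).1 x) ((mem_iff_of_supported (hinv w hw) x).2 hx)
      rwa [act_inv_act] at this
    · intro h x hx
      have := h (w.1 x) ((mem_iff_of_supported hw x).2 hx)
      rwa [mul_act, inv_act_act] at this

end Component

/-! ### Truth in a component expressed in the whole group -/

theorem below_convexCong (K : Setoid Ω) : G.ConvexCong (G.below K) := by
  refine ⟨fun g hg a b h => ?_, G.below_convex K⟩
  have hle : G.below K ≤ (G.below K).comap g := by
    refine sSup_le ?_
    rintro C hC x y hxy
    exact le_sSup (a := C) hC (hC.1.invariant g hg x y hxy)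
  exact hle h

/-- `InHull` is definable and conjugation is an automorphism, so the hull of the conjugate is the
conjugate of the hull. -/
theorem Represents.conj {g : G.toSubgroup} {B B' : Set Ω} (hr : G.Represents g B)
    {h : G.toSubgroup} (hB : ∀ x, h.1 x ∈ B' ↔ x ∈ B) : G.Represents (h * g * h⁻¹) B' := by
  have hull : ∀ k : G.toSubgroup, InHull (h * g * h⁻¹) (h * k * h⁻¹) ↔ InHull g k := by
    intro k
    obtain ⟨φ, hφ, -⟩ := UDef.inHull (A := G.toSubgroup) (B := G.toSubgroup)
      (.var (0 : Fin 2)) (.var 1)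
    have := Language.StrongHomClass.realize_formula (conjAut h) φ (v := ![g, k])
    rw [hφ, hφ] at this
    exact this
  refine ⟨fun k => ?_, fun x hx => ?_⟩
  · have hk : k = h * (h⁻¹ * k * h) * h⁻¹ := by group
    rw [hk, hull, hr.1]
    constructor
    · intro H x hx
      rw [conj_act, H, act_inv_act]
      rwa [← hB, act_inv_act]
    · intro H x hx
      have := H (h.1 x) (by rwa [hB])
      rwa [conj_act_act, act_inj] at this
  · have hx' : (h⁻¹).1 x ∈ B := by rwa [← hB, act_inv_act]
    obtain ⟨k, hk, hkx⟩ := hr.2 _ hx'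
    refine ⟨h * k * h⁻¹, fun y hy => ?_, ?_⟩
    · rw [conj_act, hk, act_inv_act]
      rwa [← hB, act_inv_act]
    · have := conj_moves (h := h) hkx
      rwa [act_inv_act] at this

/-- First-order properties of the components at a given level, expressed in the group. -/
theorem component_realize_iff {m : ℕ} {K : Fin m → Setoid Ω} (hG : G.Transitive)
    (hGa : G.Abundant) (hK : StrictMono K) (hKG : Set.range K = G.spine) (i : Fin m)
    {δ ν : ellLang.Formula (Fin 2)}
    (hδ : ∀ v : Fin 2 → G.toSubgroup, δ.Realize v ↔ InHull (v 0) (v 1))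
    (hν : ∀ v : Fin 2 → G.toSubgroup, ν.Realize v ↔ InKer i (v 0) (v 1))
    (φ : ellLang.Sentence) {Δ : Set Ω} (hΔ : Δ ∈ (K i).classes) :
    (∃ g : G.toSubgroup, HasLevel i g ∧ (translate δ ν φ).Realize fun _ => g) ↔
      (G.component (K i) Δ).toSubgroup ⊨ φ := by
  have hmem : K i ∈ G.spine := hKG ▸ Set.mem_range_self i
  have key : ∀ g : G.toSubgroup, G.Represents g Δ →
      ((translate δ ν φ).Realize (fun _ => g) ↔ (G.component (K i) Δ).toSubgroup ⊨ φ) := by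
    intro g hr
    obtain ⟨ρ, hρ⟩ := exists_isQuotient hGa hmem hΔ (below_convexCong _) (N := InKer i g)
      fun z hz => inKer_iff hG hGa hK hKG hΔ hr hz
    have := realize_translate hρ (δ := δ) (ν := ν) (g := g) (fun y => (hδ _).trans (hr.1 y))
      (fun y => hν _) φ default (fun i => i.elim0)
    have hv : (Sum.elim (fun _ => g) default : Unit ⊕ Fin 0 → G.toSubgroup) = fun _ => g := by
      ext (i | i)
      exacts [rfl, i.elim0]
    rw [hv, Subsingleton.elim (ρ ∘ default) default] at this
    exact this
  constructor
  · rintro ⟨g, ⟨hg, hg'⟩, hφ⟩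
    have hgood := hg.isGood
    obtain ⟨j, B, hB, hr⟩ := exists_class_of_isGood hG hK hKG hgood
    rw [hasChain_iff hG hGa hK hKG hB hgood hr] at hg hg'
    obtain rfl : j = i := Fin.ext (by omega)
    -- A witness `g` may represent another class of `K i`; conjugation by `h` carries it to one
    -- representing Δ and preserves the truth of the formula.
    obtain ⟨h, hh⟩ := exists_act_mem_iff hG (convexCong_of_mem_spine hmem) hB hΔ
    rw [← key _ (hr.conj hh)]
    exact (Language.StrongHomClass.realize_formula (conjAut h) (translate δ ν φ)
      (v := fun _ => g)).2 hφ
  · intro hφ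
    obtain ⟨g, hg, hr⟩ := exists_represents hG hGa hmem hΔ
    refine ⟨g, ⟨?_, ?_⟩, (key g hr).2 hφ⟩
    · exact (hasChain_iff hG hGa hK hKG hΔ hg hr).2 le_rfl
    · rw [hasChain_iff hG hGa hK hKG hΔ hg hr]
      omega

end LPermGroup

end EllPerm

/-- The definability of the root system uses only transitivity and abundance: orthogonality is
first-order in the language of lattice-ordered groups, so the hypotheses `Dagger` and `DDagger`
are not needed. -/
theorem mainTheorem9 {Ω Λ : Type*} [LinearOrder Ω] [LinearOrder Λ]
    (G : EllPerm.LPermGroup Ω) (H : EllPerm.LPermGroup Λ)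
    (hGt : G.Transitive) (hHt : H.Transitive)
    (hGa : G.Abundant) (hHa : H.Abundant)
    (hGd : G.Dagger) (hHd : H.Dagger)
    (hGdd : G.DDagger) (hHdd : H.DDagger)
    (hHG : H.toSubgroup ≅[EllPerm.ellLang] G.toSubgroup)
    (r : ℕ) (K : Fin r → Setoid Ω) (hK : StrictMono K) (hKG : Set.range K = G.spine) :
    ∃ K' : Fin r → Setoid Λ, StrictMono K' ∧ Set.range K' = H.spine ∧
      ∀ i : Fin r, ∀ Δ ∈ (K i).classes, ∀ Δ' ∈ (K' i).classes,
        (G.component (K i) Δ).toSubgroup ≅[EllPerm.ellLang]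
          (H.component (K' i) Δ').toSubgroup := by
  open EllPerm EllPerm.LPermGroup in
  have chain : ∀ n, (∃ g : G.toSubgroup, HasChain n g) ↔ ∃ h : H.toSubgroup, HasChain n h :=
    fun n => UDef.transfer (UDef.ex (UDef.hasChain n .last)) hHG.symm
  obtain ⟨m, K', hK', hKH⟩ := exists_enumeration_spine hHt hHa (n := r) (by
    rw [← chain, exists_hasChain_iff hGt hGa hK hKG]
    exact lt_irrefl r)
  -- Both `n < m` and `n < r` say that a chain of length `n` exists; `n = r` and `n = m` give the
  -- two inequalities.
  obtain rfl : m = r := by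
    have h := fun n => (exists_hasChain_iff hHt hHa hK' hKH n).symm.trans
      ((chain n).symm.trans (exists_hasChain_iff hGt hGa hK hKG n))
    exact le_antisymm (le_of_not_gt fun hlt => lt_irrefl _ ((h r).1 hlt))
      (le_of_not_gt fun hlt => lt_irrefl _ ((h m).2 hlt))
  refine ⟨K', hK', hKH, fun i Δ hΔ Δ' hΔ' => Language.elementarilyEquivalent_iff.2 fun φ => ?_⟩
  -- The same formulas `δ` and `ν` serve both groups, so `φ` has one common translation.
  obtain ⟨δ, hδ, hδ'⟩ := UDef.inHull (A := G.toSubgroup) (B := H.toSubgroup)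
    (.var (0 : Fin 2)) (.var 1)
  obtain ⟨ν, hν, hν'⟩ := UDef.inKer (A := G.toSubgroup) (B := H.toSubgroup) i
    (.var (0 : Fin 2)) (.var 1)
  rw [← component_realize_iff hGt hGa hK hKG i hδ hν φ hΔ,
    ← component_realize_iff hHt hHa hK' hKH i hδ' hν' φ hΔ']
  exact UDef.transfer (UDef.ex (UDef.and (UDef.hasLevel i .last)
    ⟨(translate δ ν φ).relabel fun _ => Sum.inr (),
      fun _ => Language.Formula.realize_relabel, fun _ => Language.Formula.realize_relabel⟩))
    hHG.symm
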